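/- A $k$-uniform hypergraph is a pair $(V,E)$ of a finite vertex set $V$ and a set $E$ of $k$-element subsets of $V$ (the edges). For $k$-uniform hypergraphs $\mathcal G,\mathcal H$, the Ramsey number $R(\mathcal G,\mathcal H)$ is the smallest positive integer $N$ such that every red-blue colouring of the edges of the complete $k$-uniform hypergraph on $N$ vertices contains a red copy of $\mathcal G$ or a blue copy of $\mathcal H$, where a copy of $\mathcal G$ in a hypergraph $\mathcal F$ is an injective map from the vertices of $\mathcal G$ to the vertices of $\mathcal F$ that sends edges to edges, and the red (blue) hypergraph consists of all $N$ vertices and the red (blue) edges. Write $n\mathcal H$ for the disjoint union of $n$ copies of $\mathcal H$, and let $\mathcal K_p^k$ be the complete $k$-uniform hypergraph on $p$ vertices, so that $\mathcal K_k^k$ is a single edge. The loose cycle $\mathcal C_r^k$ has vertices $v_1,\dots,v_{r(k-1)}$ and the $r$ edges $\{v_{1+i(k-1)},v_{2+i(k-1)},\dots,v_{k+i(k-1)}\}$, $0\le i\le r-1$, with subscripts modulo $r(k-1)$. The loose path $\mathcal P_r^k$ has vertices $v_1,\dots,v_{r(k-1)+1}$ and the same edges without reduction of the subscripts. The star $\mathcal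 S_r^k$ has vertices $v,v_1,\dots,v_{r(k-1)}$ and the $r$ edges $\{v,v_{1+i(k-1)},\dots,v_{(k-1)+i(k-1)}\}$, $0\le i\le r-1$. Theorem. Let $k\ge 3$ and $m\ge n\ge 1$ be integers. Then: (i) $R(m\mathcal C_3^k,n\mathcal C_3^k)=m(3k-3)+2n-1$ and $R(m\mathcal C_4^k,n\mathcal C_3^k)=R(m\mathcal C_4^k,n\mathcal C_4^k)=m(4k-4)+2n-1$. (ii) $R(m\mathcal P_3^k,n\mathcal C_3^k)=m(3k-2)+2n-1$ and $R(m\mathcal P_4^k,n\mathcal C_3^k)=R(m\mathcal P_4^k,n\mathcal C_4^k)=m(4k-3)+2n-1$. (iii) $R(m\mathcal P_3^k,n\mathcal P_3^k)=m(3k-2)+2n-1$ and $R(m\mathcal P_4^k,n\mathcal P_3^k)=R(m\mathcal P_4^k,n\mathcal P_4^k)=m(4k-3)+2n-1$. (iv) $R(m\mathcal S_3^k,n\mathcal S_3^k)=m(3k-2)+n-1$. (v) For every $k$-uniform hypergraph $\mathcal H$ with at least one vertex and, if $n\ge 2$, without isolated vertices (vertices that lie in no edge), $R(m\mathcal H,n\mathcal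 K_k^k)=m|V(\mathcal H)|+n-1$. In particular, $R(m\mathcal K_k^k,n\mathcal K_k^k)=mk+n-1$. -/

import Mathlib

namespace Hypergraph

/-- `H` is `k`-uniform: every edge has exactly `k` vertices. -/
def IsUniform {α : Type*} (H : Hypergraph α) (k : ℕ) : Prop :=
  ∀ e ∈ H.edgeSet, e.encard = k

/-- `H` contains a copy of `G`: some map, injective on the vertices of `G`, sends the vertices of
`G` to vertices of `H` and the edges of `G` to edges of `H` (not necessarily induced). -/
def ContainsCopy {α β : Type*} (H : Hypergraph β) (G : Hypergraph α) : Prop :=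
  ∃ f : α → β, Set.InjOn f G.vertexSet ∧
    (G.image f).vertexSet ⊆ H.vertexSet ∧ (G.image f).edgeSet ⊆ H.edgeSet

/-- The disjoint union of `n` copies of `H`. -/
def copies {α : Type*} (n : ℕ) (H : Hypergraph α) : Hypergraph (Fin n × α) where
  vertexSet := {p | p.2 ∈ H.vertexSet}
  edgeSet := {e | ∃ i : Fin n, ∃ f ∈ H.edgeSet, e = (fun x => (i, x)) '' f}
  subset_vertexSet_of_mem_edgeSet' := by
    rintro _ ⟨i, f, hf, rfl⟩ _ ⟨x, hx, rfl⟩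
    exact H.subset_vertexSet_of_mem_edgeSet' hf hx

/-- The complete `k`-uniform hypergraph on `p` vertices. -/
def completeUniform (p k : ℕ) : Hypergraph (Fin p) where
  vertexSet := Set.univ
  edgeSet := {e | e.encard = k}
  subset_vertexSet_of_mem_edgeSet' := fun _ _ => Set.subset_univ _

/-- The `k`-uniform loose cycle with `n` edges: its vertices are the integers modulo `n (k - 1)`,
and its edges are the shifts of `{0, 1, …, k - 1}` by `i (k - 1)` for `i = 0, …, n - 1`. -/
def looseCycle (n k : ℕ) : Hypergraph (ZMod (n * (k - 1))) where
  vertexSet := Set.univ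
  edgeSet := {e | ∃ i < n, e = {x | ∃ j < k, x = ((i * (k - 1) + j : ℕ) : ZMod (n * (k - 1)))}}
  subset_vertexSet_of_mem_edgeSet' := fun _ _ => Set.subset_univ _

/-- The `k`-uniform loose path with `n` edges: its vertices are `0, 1, …, n (k - 1)`, and its
edges are the shifts of `{0, 1, …, k - 1}` by `i (k - 1)` for `i = 0, …, n - 1`. -/
def loosePath (n k : ℕ) : Hypergraph (Fin (n * (k - 1) + 1)) where
  vertexSet := Set.univ
  edgeSet := {e | ∃ i < n, e = {x : Fin (n * (k - 1) + 1) | ∃ j < k, (x : ℕ) = i * (k - 1) + j}}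
  subset_vertexSet_of_mem_edgeSet' := fun _ _ => Set.subset_univ _

/-- The `k`-uniform star with `n` edges: its vertices are `0, 1, …, n (k - 1)`, where `0` is the
centre, and its edges consist of the centre and a shift of `{1, …, k - 1}` by `i (k - 1)` for
`i = 0, …, n - 1`. -/
def starUniform (n k : ℕ) : Hypergraph (Fin (n * (k - 1) + 1)) where
  vertexSet := Set.univ
  edgeSet := {e | ∃ i < n,
    e = {x : Fin (n * (k - 1) + 1) | (x : ℕ) = 0 ∨
      ∃ j : ℕ, 1 ≤ j ∧ j ≤ k - 1 ∧ (x : ℕ) = i * (k - 1) + j}}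
  subset_vertexSet_of_mem_edgeSet' := fun _ _ => Set.subset_univ _

/-- The edges of colour `b` in a two-colouring `c` of the edges of `H`, on the vertices of `H`. -/
def colorClass {α : Type*} (H : Hypergraph α) (c : H.edgeSet → Bool) (b : Bool) :
    Hypergraph α where
  vertexSet := H.vertexSet
  edgeSet := {e | ∃ h : e ∈ H.edgeSet, c ⟨e, h⟩ = b}
  subset_vertexSet_of_mem_edgeSet' := fun _ he => H.subset_vertexSet_of_mem_edgeSet' he.1

/-- Every red-blue colouring (`true` is red, `false` is blue) of the edges of the complete
`k`-uniform hypergraph on `N` vertices has a red copy of `G` or a blue copy of `H`. -/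
def Arrows {α β : Type*} (k N : ℕ) (G : Hypergraph α) (H : Hypergraph β) : Prop :=
  ∀ c : (completeUniform N k).edgeSet → Bool,
    ((completeUniform N k).colorClass c true).ContainsCopy G ∨
      ((completeUniform N k).colorClass c false).ContainsCopy H

/-- `R(G, H) = r` for `k`-uniform hypergraphs `G` and `H`: the number `r` is the smallest positive
integer `N` for which every red-blue colouring of the edges of the complete `k`-uniform hypergraph
on `N` vertices has a red copy of `G` or a blue copy of `H`. -/
def IsRamseyNumber {α β : Type*} (k : ℕ) (G : Hypergraph α) (H : Hypergraph β) (r : ℕ) : Prop :=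
  IsLeast {N : ℕ | 0 < N ∧ Arrows k N G H} r

end Hypergraph

/-!
The Ramsey numbers of multiple copies of short loose cycles, loose paths, stars and single edges.

**From one copy to many** (`isRamseyNumber_copies`). Let `p = |V(G)| ≥ |V(H)|`, where `G` has no isolated
vertices. Suppose that every set meeting all edges of `H` has at least `t` vertices, and that
`p + t - 1` vertices force a red copy of `G` or a blue copy of `H`. Then `R(mG, nH) = mp + tn - 1`. For the lower bound, the edges
that meet a fixed set of `tn - 1` vertices are blue and all others are red. For the upper bound, a
red `G` is removed while `m > n`. When `m = n` and both colours occur, some `(p + t - 1)`-set with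
a red `G` and some `(p + t - 1)`-set with a blue `H` differ by at most one exchange of vertices
(`exists_union_card_le`), so that removing both costs only `p + t` vertices. It remains to treat
single copies, where `t = 2` for cycles and paths and `t = 1` for stars and single edges.

**Triangles and stars on `3k - 2` vertices** (`Propagates.eq`). If `A ∪ {x}` and `A ∪ {y}` have
different colours and there is no monochromatic triangle (or star), then `{a₁} ∪ D₁` and
`{a₂} ∪ D₂` have different colours for all `a₁ ≠ a₂` in `A` and all `D₁, D₂` outside `A ∪ {x, y}`
with one common element. As the Johnson graph is connected, this forces three two-valued colours
to be pairwise different. Hence all edges have the same colour, which is absurd.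

**Four-cycles on `4k - 3` vertices** (`exists_monoQuad`). If there is no monochromatic four-cycle,
then no pair of vertices `x, y` and disjoint `A, A'` satisfies: `A ∪ {x}` and `A' ∪ {y}` are red,
`A ∪ {y}` and `A' ∪ {x}` are blue (`not_crossing`). It follows that shifting the red edges towards
larger vertices creates no monochromatic four-cycle (`not_monoQuad_shift`), and one may assume that
the colouring is shifted. If then an edge of the lowest possible four-cycle is red, it is dominated
by every edge of the reversed cycle, which is therefore red; otherwise the lowest four-cycle is blue
(`IsShifted.exists_monoQuad`).

**The other pairs.** Missing configurations of one colour force the edges that would complete them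
to have the other colour, and these contain the desired configurations: a four-cycle of one colour
without triangles of that colour gives a four-cycle of the other colour
(`MonoQuad.not_of_not_monoTri`); a cycle with two further vertices gives a path of the same colour,
or cycles and a path of the other colour (`MonoTri.monoPath3_or`, `MonoQuad.monoPath4_or`).
-/

namespace Hypergraph

/-! ### Multiple copies and the bounds for the Ramsey number -/

/-- `CopyIn k c b S G`: the vertices in `S` carry a copy of `G` all of whose edges are `k`-sets of
colour `b` in the colouring `c`. Colourings are defined on all finite sets of vertices, but only
their values on `k`-sets matter. -/
def CopyIn {α V : Type*} (k : ℕ) (c : Finset V → Bool) (b : Bool) (S : Finset V)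
    (G : Hypergraph α) : Prop :=
  ∃ f : α → V, Set.InjOn f G.vertexSet ∧ (∀ v ∈ G.vertexSet, f v ∈ S) ∧
    ∀ e ∈ G.edgeSet, ∃ s : Finset V, s.card = k ∧ (s : Set V) = f '' e ∧ c s = b

/-- Every red-blue colouring of the `k`-subsets of an `r`-element set has a red copy of `G` or a
blue copy of `H`. -/
def Forces {α β : Type*} (k r : ℕ) (G : Hypergraph α) (H : Hypergraph β) : Prop :=
  ∀ (V : Type) [Fintype V] (c : Finset V → Bool), Fintype.card V = r →
    CopyIn k c true Finset.univ G ∨ CopyIn k c false Finset.univ H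

section Copies

variable {α β V W : Type*} {k : ℕ} {c : Finset V → Bool} {b : Bool} {S T : Finset V}
  {G : Hypergraph α}

lemma CopyIn.mono (h : CopyIn k c b S G) (hST : S ⊆ T) : CopyIn k c b T G := by
  obtain ⟨f, hf, hS, he⟩ := h
  exact ⟨f, hf, fun v hv => hST (hS v hv), he⟩

lemma CopyIn.map (ι : W ↪ V) {S : Finset W}
    (h : CopyIn k (fun s => c (s.map ι)) b S G) : CopyIn k c b (S.map ι) G := by
  obtain ⟨f, hf, hS, he⟩ := h
  refine ⟨ι ∘ f, ι.injective.comp_injOn hf, fun v hv => ?_, fun e hee => ?_⟩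
  · exact Finset.mem_map_of_mem ι (hS v hv)
  · obtain ⟨s, hs, hse, hc⟩ := he e hee
    exact ⟨s.map ι, by simpa using hs, by rw [Finset.coe_map, hse, Set.image_image]; rfl, hc⟩

/-- A copy can be confined to exactly as many vertices as it needs. -/
lemma CopyIn.exists_card_eq (h : CopyIn k c b S G) (hG : G.vertexSet.Finite) :
    ∃ T ⊆ S, T.card = G.vertexSet.ncard ∧ CopyIn k c b T G := by
  classical
  obtain ⟨f, hf, hS, he⟩ := h
  refine ⟨hG.toFinset.image f, ?_, ?_, f, hf, ?_, he⟩
  · intro v hv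
    obtain ⟨w, hw, rfl⟩ := Finset.mem_image.1 hv
    exact hS w (by simpa using hw)
  · rw [Finset.card_image_of_injOn (by simpa using hf), Set.ncard_eq_toFinset_card _ hG]
  · intro v hv
    exact Finset.mem_image_of_mem f (by simpa using hv)

lemma copyIn_copies_zero : CopyIn k c b S (G.copies 0) := by
  refine ⟨fun p => p.1.elim0, fun p => p.1.elim0, fun p => p.1.elim0, ?_⟩
  rintro e ⟨i, -⟩
  exact i.elim0

lemma CopyIn.cons [DecidableEq V] {n : ℕ} (h₁ : CopyIn k c b S G)
    (h₂ : CopyIn k c b T (G.copies n)) (hST : Disjoint S T) :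
    CopyIn k c b (S ∪ T) (G.copies (n + 1)) := by
  obtain ⟨f, hf, hfS, hfe⟩ := h₁
  obtain ⟨g, hg, hgT, hge⟩ := h₂
  have hne : ∀ v ∈ G.vertexSet, ∀ w ∈ (G.copies n).vertexSet, f v ≠ g w := fun v hv w hw h =>
    Finset.disjoint_left.1 hST (hfS v hv) (h ▸ hgT w hw)
  refine ⟨fun p => Fin.cases (f p.2) (fun j => g (j, p.2)) p.1, ?_, ?_, ?_⟩
  · rintro ⟨i, v⟩ hv ⟨j, w⟩ hw h
    induction i using Fin.cases with
    | zero =>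
      induction j using Fin.cases with
      | zero => exact congrArg _ (hf hv hw h)
      | succ j => exact absurd h (hne v hv (j, w) hw)
    | succ i =>
      induction j using Fin.cases with
      | zero => exact absurd h.symm (hne w hw (i, v) hv)
      | succ j =>
        have := hg (show (i, v) ∈ (G.copies n).vertexSet from hv) hw h
        simp_all
  · rintro ⟨i, v⟩ hv
    induction i using Fin.cases with
    | zero => exact Finset.mem_union_left _ (hfS v hv)
    | succ i => exact Finset.mem_union_right _ (hgT (i, v) hv)
  · rintro e ⟨i, e, he, rfl⟩
    induction i using Fin.cases with
    | zero =>
      obtain ⟨s, hs, hse, hc⟩ := hfe e he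
      exact ⟨s, hs, by rw [hse, Set.image_image]; rfl, hc⟩
    | succ i =>
      obtain ⟨s, hs, hse, hc⟩ := hge _ ⟨i, e, he, rfl⟩
      exact ⟨s, hs, by rw [hse, Set.image_image, Set.image_image]; rfl, hc⟩

/-- If every subset of `S` with at least `r` elements carries a copy of `G`, then disjoint copies can
be removed from `S` greedily as long as `r` elements remain. -/
lemma copyIn_copies_of_forall [DecidableEq V] {r : ℕ} (hG : G.vertexSet.Finite)
    (h : ∀ U ⊆ S, r ≤ U.card → CopyIn k c b U G) (n : ℕ)
    (hS : n * G.vertexSet.ncard + r ≤ S.card) : CopyIn k c b S (G.copies (n + 1)) := by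
  induction n generalizing S with
  | zero =>
    obtain ⟨T, hTS, -, hT⟩ := (h S subset_rfl (by omega)).exists_card_eq hG
    exact (hT.cons (T := ∅) copyIn_copies_zero (by simp)).mono (by simpa using hTS)
  | succ n ih =>
    rw [add_mul] at hS
    obtain ⟨T, hTS, hTc, hT⟩ := (h S subset_rfl (by omega)).exists_card_eq hG
    have hcard : (S \ T).card + T.card = S.card := Finset.card_sdiff_add_card_eq_card hTS
    have := ih (S := S \ T) (fun U hU => h U (hU.trans Finset.sdiff_subset)) (by omega)
    exact (hT.cons this Finset.disjoint_sdiff).mono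
      (Finset.union_subset hTS Finset.sdiff_subset)

end Copies

section Upper

variable {α β : Type*} {k : ℕ} {G : Hypergraph α} {H : Hypergraph β}

lemma CopyIn.containsCopy {N : ℕ} {b : Bool} {col : (completeUniform N k).edgeSet → Bool}
    {c : Finset (Fin N) → Bool}
    (hc : ∀ s : Finset (Fin N), ∀ h : (s : Set (Fin N)) ∈ (completeUniform N k).edgeSet,
      c s = col ⟨s, h⟩)
    (h : CopyIn k c b Finset.univ G) :
    ((completeUniform N k).colorClass col b).ContainsCopy G := by
  obtain ⟨f, hf, -, he⟩ := h
  refine ⟨f, hf, Set.subset_univ _, ?_⟩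
  rintro _ ⟨e, hee, rfl⟩
  obtain ⟨s, hs, hse, hcs⟩ := he e hee
  have hmem : (s : Set (Fin N)) ∈ (completeUniform N k).edgeSet := by
    simp [completeUniform, Set.encard_coe_eq_coe_finsetCard, hs]
  change f '' e ∈ ((completeUniform N k).colorClass col b).edgeSet
  rw [← hse]
  exact ⟨hmem, (hc s hmem).symm.trans hcs⟩

lemma arrows_of_forces {N : ℕ} (h : Forces k N G H) : Arrows k N G H := by
  classical
  intro col
  let c : Finset (Fin N) → Bool := fun s =>
    if h : (s : Set (Fin N)) ∈ (completeUniform N k).edgeSet then col ⟨s, h⟩ else true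
  have hc : ∀ s : Finset (Fin N), ∀ h : (s : Set (Fin N)) ∈ (completeUniform N k).edgeSet,
      c s = col ⟨s, h⟩ := fun s h => dif_pos h
  exact (h (Fin N) c (by simp)).imp (CopyIn.containsCopy hc) (CopyIn.containsCopy hc)

lemma Forces.finset {r : ℕ} (h : Forces k r G H) {V : Type} (c : Finset V → Bool) (S : Finset V)
    (hS : r ≤ S.card) : CopyIn k c true S G ∨ CopyIn k c false S H := by
  obtain ⟨T, hTS, hT⟩ := Finset.exists_subset_card_eq hS
  have hmap : (Finset.univ : Finset T).map (Function.Embedding.subtype _) = T := by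
    ext; simp
  refine (h T (fun s => c (s.map (Function.Embedding.subtype _))) (by simpa using hT)).imp ?_ ?_
  all_goals
    intro h'
    have := h'.map
    rw [hmap] at this
    exact this.mono hTS

/-- If each `r`-subset of `S` satisfies `P` or `Q`, and both occur, then some set satisfying `P` and
some set satisfying `Q` differ by at most one exchange of elements. -/
lemma exists_union_card_le {V : Type*} [DecidableEq V] {r : ℕ} {S : Finset V}
    {P Q : Finset V → Prop} (hPQ : ∀ U ⊆ S, U.card = r → P U ∨ Q U) {A B : Finset V} (hA : A ⊆ S)
    (hAr : A.card = r) (hPA : P A) (hB : B ⊆ S) (hBr : B.card = r) (hQB : Q B) :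
    ∃ A' ⊆ S, ∃ B' ⊆ S, P A' ∧ Q B' ∧ (A' ∪ B').card ≤ r + 1 := by
  induction hd : (A \ B).card generalizing A with
  | zero =>
    have : A = B := Finset.eq_of_subset_of_card_le
      (Finset.sdiff_eq_empty_iff_subset.1 (Finset.card_eq_zero.1 hd)) (by omega)
    subst this
    exact ⟨A, hA, A, hA, hPA, hQB, by simp; omega⟩
  | succ d ih =>
    obtain ⟨x, hx⟩ : (A \ B).Nonempty := Finset.card_pos.1 (by omega)
    have h1 := Finset.card_sdiff_add_card_inter A B
    have h2 := Finset.card_sdiff_add_card_inter B A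
    rw [Finset.inter_comm] at h2
    obtain ⟨y, hy⟩ : (B \ A).Nonempty := Finset.card_pos.1 (by omega)
    rw [Finset.mem_sdiff] at hx hy
    have hye : y ∉ A.erase x := fun h => hy.2 (Finset.mem_of_mem_erase h)
    have hC : insert y (A.erase x) ⊆ S :=
      Finset.insert_subset (hB hy.1) ((Finset.erase_subset _ _).trans hA)
    have hpos : 0 < A.card := Finset.card_pos.2 ⟨x, hx.1⟩
    have hCr : (insert y (A.erase x)).card = r := by
      rw [Finset.card_insert_of_notMem hye, Finset.card_erase_of_mem hx.1]; omega
    rcases hPQ _ hC hCr with h | h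
    · refine ih hC hCr h ?_
      have : insert y (A.erase x) \ B = (A \ B).erase x := by
        ext z; simp only [Finset.mem_sdiff, Finset.mem_insert, Finset.mem_erase]
        clear * - hx hy
        grind
      rw [this, Finset.card_erase_of_mem (by simpa using hx)]; omega
    · refine ⟨A, hA, _, hC, hPA, h, ?_⟩
      have : A ∪ insert y (A.erase x) = insert y A := by
        ext z; simp only [Finset.mem_union, Finset.mem_insert, Finset.mem_erase]
        clear * - hx hy
        grind
      rw [this, Finset.card_insert_of_notMem hy.2]; omega

/-- The upper bound for multiple copies: induction on `m`, removing a red copy of `G` if `n < m`, and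
an overlapping pair of a red copy of `G` and a blue copy of `H` if `n = m`. -/
lemma copyIn_copies_or {V : Type} (c : Finset V → Bool) {t m n : ℕ} (ht : 1 ≤ t)
    (hG : G.vertexSet.Finite) (hH : H.vertexSet.Finite)
    (hf : Forces k (G.vertexSet.ncard + t - 1) G H) (hnm : n ≤ m)
    (hle : 2 ≤ n → H.vertexSet.ncard ≤ G.vertexSet.ncard) (S : Finset V)
    (hS : m * G.vertexSet.ncard + t * n ≤ S.card + 1) :
    CopyIn k c true S (G.copies m) ∨ CopyIn k c false S (H.copies n) := by
  classical
  induction m generalizing n S with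
  | zero => exact .inl copyIn_copies_zero
  | succ m ih =>
    rcases n with _ | n
    · exact .inr copyIn_copies_zero
    rw [add_mul, mul_add] at hS
    have hnp : n * H.vertexSet.ncard ≤ n * G.vertexSet.ncard := by
      rcases Nat.eq_zero_or_pos n with rfl | h
      · simp
      · exact Nat.mul_le_mul_left _ (hle (by omega))
    have hmp : n * G.vertexSet.ncard ≤ m * G.vertexSet.ncard := Nat.mul_le_mul_right _ (by omega)
    by_cases hred : CopyIn k c true S G
    swap
    · -- there is no red copy of `G`, so blue copies of `H` can be collected greedily
      refine .inr (copyIn_copies_of_forall (r := G.vertexSet.ncard + t - 1) hH (fun U hU hUr => ?_) n (by omega))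
      exact (hf.finset c U hUr).resolve_left fun h => hred (h.mono hU)
    rcases Nat.lt_or_ge n m with hlt | hge
    · obtain ⟨T, hTS, hTc, hT⟩ := hred.exists_card_eq hG
      have hcard := Finset.card_sdiff_add_card_eq_card hTS
      refine (ih (n := n + 1) hlt hle (S \ T) (by rw [mul_add]; omega)).imp ?_ ?_
      · exact fun h => (hT.cons h Finset.disjoint_sdiff).mono
          (Finset.union_subset hTS Finset.sdiff_subset)
      · exact fun h => h.mono Finset.sdiff_subset
    obtain rfl : n = m := by omega
    by_cases hblue : CopyIn k c false S H
    swap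
    · refine .inl (copyIn_copies_of_forall (r := G.vertexSet.ncard + t - 1) hG (fun U hU hUr => ?_) n (by omega))
      exact (hf.finset c U hUr).resolve_right fun h => hblue (h.mono hU)
    rcases Nat.eq_zero_or_pos n with rfl | hn
    · refine (hf.finset c S (by omega)).imp (fun h => ?_) (fun h => ?_)
      · exact copyIn_copies_of_forall (r := S.card) hG
          (fun U hU hUr => by rwa [Finset.eq_of_subset_of_card_le hU hUr]) 0 (by simp)
      · exact copyIn_copies_of_forall (r := S.card) hH
          (fun U hU hUr => by rwa [Finset.eq_of_subset_of_card_le hU hUr]) 0 (by simp)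
    -- remove a red copy of `G` and a blue copy of `H` that overlap in all but `t` vertices
    have hqp : H.vertexSet.ncard ≤ G.vertexSet.ncard := hle (by omega)
    have hext : ∀ (T : Finset V), T ⊆ S → T.card ≤ G.vertexSet.ncard →
        ∃ U, T ⊆ U ∧ U ⊆ S ∧ U.card = G.vertexSet.ncard + t - 1 := fun T hT hTc =>
      Finset.exists_subsuperset_card_eq hT (by omega) (by omega)
    obtain ⟨T₁, hT₁S, hT₁c, hT₁⟩ := hred.exists_card_eq hG
    obtain ⟨T₂, hT₂S, hT₂c, hT₂⟩ := hblue.exists_card_eq hH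
    obtain ⟨U₁, hTU₁, hUS₁, hU₁⟩ := hext T₁ hT₁S hT₁c.le
    obtain ⟨U₂, hTU₂, hUS₂, hU₂⟩ := hext T₂ hT₂S (hT₂c.trans_le hqp)
    obtain ⟨A, hAS, B, hBS, hA, hB, hAB⟩ := exists_union_card_le
      (P := fun U => CopyIn k c true U G) (Q := fun U => CopyIn k c false U H)
      (fun U _ hU => hf.finset c U hU.ge) hUS₁ hU₁ (hT₁.mono hTU₁) hUS₂ hU₂ (hT₂.mono hTU₂)
    have hABS := Finset.union_subset hAS hBS
    have hcard := Finset.card_sdiff_add_card_eq_card hABS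
    refine (ih (n := n) le_rfl (fun h => hqp) (S \ (A ∪ B)) (by omega)).imp ?_ ?_
    · exact fun h => ((hA.mono Finset.subset_union_left).cons h Finset.disjoint_sdiff).mono
          (Finset.union_subset hABS Finset.sdiff_subset)
    · exact fun h => ((hB.mono Finset.subset_union_right).cons h Finset.disjoint_sdiff).mono
          (Finset.union_subset hABS Finset.sdiff_subset)

end Upper

section Lower

variable {α β : Type*} {k : ℕ} {G : Hypergraph α} {H : Hypergraph β}

/-- The lower bound: edges that meet a set of `t * n - 1` vertices are blue, all others are red. -/
lemma not_arrows_copies {N m n t : ℕ} (hH : H.vertexSet.Finite)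
    (hG : t * n = 1 ∨ ∀ x ∈ G.vertexSet, ¬ G.IsIsolated x)
    (hcov : ∀ T ⊆ H.vertexSet, (∀ e ∈ H.edgeSet, (e ∩ T).Nonempty) → t ≤ T.ncard)
    (ht : 1 ≤ t * n) (hm : 1 ≤ m * G.vertexSet.ncard)
    (hN : N + 1 < m * G.vertexSet.ncard + t * n) :
    ¬ Arrows k N (G.copies m) (H.copies n) := by
  classical
  intro h
  let B : Finset (Fin N) := Finset.univ.filter fun i => i.val < t * n - 1
  have hB : B.card = min N (t * n - 1) := by
    rw [Fin.card_filter_val_lt]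
  let col : (completeUniform N k).edgeSet → Bool := fun e => decide (∀ i ∈ B, i ∉ e.1)
  rcases h col with ⟨f, hf, -, he⟩ | ⟨f, hf, -, he⟩
  · -- a red copy of `m G` has no vertex in `B`
    have hout : ∀ v ∈ (G.copies m).vertexSet, f v ∉ B := by
      rintro ⟨i, v⟩ hv hvB
      rcases hG with h1 | h1
      · simp [B, h1] at hvB
      · have := h1 v hv
        simp only [IsIsolated, not_forall, not_not] at this
        obtain ⟨e, hee, hve⟩ := this
        obtain ⟨h2, h3⟩ := he ⟨_, ⟨i, e, hee, rfl⟩, rfl⟩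
        have h4 : ∀ j ∈ B, j ∉ f '' ((fun x => (i, x)) '' e) := by
          simpa only [col, decide_eq_true_eq] using h3
        exact h4 _ hvB ⟨_, ⟨v, hve, rfl⟩, rfl⟩
    have hcard : (G.copies m).vertexSet.ncard = m * G.vertexSet.ncard := by
      have : (G.copies m).vertexSet = (Set.univ : Set (Fin m)) ×ˢ G.vertexSet := by
        ext; simp [copies]
      rw [this, Set.ncard_prod]; simp
    have h5 : (G.copies m).vertexSet.ncard ≤ (Bᶜ).card := by
      rw [← hf.ncard_image, ← Set.ncard_coe_finset]
      refine Set.ncard_le_ncard ?_ (Finset.finite_toSet _)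
      rintro _ ⟨v, hv, rfl⟩
      simpa using hout v hv
    rw [Finset.card_compl, hB, Fintype.card_fin, hcard] at h5
    omega
  · -- each of the `n` blue copies of `H` has at least `t` vertices in `B`
    let T : Fin n → Finset β := fun i => hH.toFinset.filter fun v => f (i, v) ∈ B
    have hT : ∀ i, t ≤ (T i).card := by
      intro i
      have h1 : t ≤ (T i : Set β).ncard := by
        refine hcov _ (fun v hv => by simp [T] at hv; exact hv.1) fun e hee => ?_
        obtain ⟨h2, h3⟩ := he ⟨_, ⟨i, e, hee, rfl⟩, rfl⟩
        have h4 : ¬ ∀ j ∈ B, j ∉ f '' ((fun x => (i, x)) '' e) := by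
          simpa only [col, decide_eq_false_iff_not] using h3
        push Not at h4
        obtain ⟨_, hj, ⟨_, ⟨v, hv, rfl⟩, rfl⟩⟩ := h4
        exact ⟨v, hv, by simpa [T, hj] using H.subset_vertexSet_of_mem_edgeSet hee hv⟩
      rwa [Set.ncard_coe_finset] at h1
    have hinj : ∀ i, ∀ v ∈ T i, (i, v) ∈ (H.copies n).vertexSet := by
      intro i v hv
      simp only [T, Finset.mem_filter, Set.Finite.mem_toFinset] at hv
      exact hv.1
    have h5 : (Finset.univ.sigma T).card ≤ B.card := by
      refine Finset.card_le_card_of_injOn (fun p => f (p.1, p.2)) ?_ ?_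
      · rintro ⟨i, v⟩ hv
        have hv : v ∈ T i := by simpa using hv
        simp only [T, Finset.mem_filter] at hv
        exact hv.2
      · rintro ⟨i, v⟩ hv ⟨j, w⟩ hw h
        have := hf (hinj i v (by simpa using hv)) (hinj j w (by simpa using hw)) h
        simp_all
    rw [Finset.card_sigma, hB] at h5
    have h6 : n * t ≤ ∑ i, (T i).card := by
      simpa using Finset.card_nsmul_le_sum Finset.univ (fun i => (T i).card) t (fun i _ => hT i)
    rw [mul_comm] at h6
    omega

end Lower

/-- The Ramsey number of multiple copies: if the bound `|V(G)| + t - 1` suffices for single copies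
of `G` and `H` and every set meeting all edges of `H` has at least `t` vertices, then
`R(m G, n H) = m |V(G)| + t n - 1`. -/
theorem isRamseyNumber_copies {α β : Type*} {k m n t : ℕ} {G : Hypergraph α} {H : Hypergraph β}
    (ht : 1 ≤ t) (hn : 1 ≤ n) (hnm : n ≤ m)
    (hGf : G.vertexSet.Finite) (hHf : H.vertexSet.Finite) (hG0 : 1 ≤ G.vertexSet.ncard)
    (hle : 2 ≤ n → H.vertexSet.ncard ≤ G.vertexSet.ncard)
    (hG : t * n = 1 ∨ ∀ x ∈ G.vertexSet, ¬ G.IsIsolated x)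
    (hcov : ∀ T ⊆ H.vertexSet, (∀ e ∈ H.edgeSet, (e ∩ T).Nonempty) → t ≤ T.ncard)
    (hf : Forces k (G.vertexSet.ncard + t - 1) G H) :
    IsRamseyNumber k (G.copies m) (H.copies n) (m * G.vertexSet.ncard + t * n - 1) := by
  have h1 : 1 ≤ t * n := Nat.mul_pos ht hn
  have h2 : 1 ≤ m * G.vertexSet.ncard := Nat.mul_pos (by omega) hG0
  refine ⟨⟨by omega, arrows_of_forces fun V _ c hV => ?_⟩, fun N hN => ?_⟩
  · exact copyIn_copies_or c ht hGf hHf hf hnm hle Finset.univ (by rw [Finset.card_univ]; omega)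
  · by_contra hlt
    exact not_arrows_copies hHf hG hcov h1 h2 (by omega) hN.2

/-! ### Block enumerations and copies of cycles, paths and stars -/

section Blocks

variable {V : Type*} {k : ℕ} {c : Finset V → Bool} {b : Bool}

lemma exists_enum (D : Finset V) {p : V} (hp : p ∈ D) :
    ∃ g : ℕ → V, g 0 = p ∧ Set.InjOn g (Set.Iio D.card) ∧
      ∀ v, v ∈ D ↔ ∃ j < D.card, g j = v := by
  classical
  set l := p :: (D.erase p).toList with hl
  have hlen : l.length = D.card := by
    have : 0 < D.card := Finset.card_pos.2 ⟨p, hp⟩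
    simp [hl, Finset.card_erase_of_mem hp]; omega
  have hnd : l.Nodup := by simp [hl, Finset.nodup_toList]
  have hmem : ∀ v, v ∈ l ↔ v ∈ D := by
    intro v
    by_cases h : v = p <;> simp [hl, h, hp]
  refine ⟨fun j => l.getD j p, by simp [hl], ?_, fun v => ?_⟩
  · intro i hi j hj h
    rw [Set.mem_Iio, ← hlen] at hi hj
    beta_reduce at h
    rw [List.getD_eq_getElem _ _ hi, List.getD_eq_getElem _ _ hj] at h
    exact (hnd.getElem_inj_iff).1 h
  · rw [← hmem, List.mem_iff_getElem, ← hlen]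
    constructor
    · rintro ⟨i, hi, h⟩
      exact ⟨i, hi, by beta_reduce; rwa [List.getD_eq_getElem _ _ hi]⟩
    · rintro ⟨i, hi, h⟩
      exact ⟨i, hi, by beta_reduce at h; rwa [List.getD_eq_getElem _ _ hi] at h⟩

/-- Pairwise disjoint blocks `D 0, …, D (n - 1)` of `K` elements can be enumerated one after the
other, each starting at a prescribed element. -/
lemma exists_block_enum {n K : ℕ} {D : ℕ → Finset V} {p : ℕ → V} (hK : 0 < K)
    (hD : ∀ i < n, (D i).card = K) (hp : ∀ i < n, p i ∈ D i)
    (hdis : ∀ i < n, ∀ j < n, i ≠ j → Disjoint (D i) (D j)) :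
    ∃ F : ℕ → V, Set.InjOn F (Set.Iio (n * K)) ∧ (∀ i < n, F (i * K) = p i) ∧
      ∀ i < n, ∀ v, v ∈ D i ↔ ∃ j < K, F (i * K + j) = v := by
  have : ∀ i, ∃ g : ℕ → V, i < n → g 0 = p i ∧ Set.InjOn g (Set.Iio K) ∧
      ∀ v, v ∈ D i ↔ ∃ j < K, g j = v := by
    intro i
    by_cases hi : i < n
    · obtain ⟨g, h⟩ := exists_enum (D i) (hp i hi)
      rw [hD i hi] at h
      exact ⟨g, fun _ => h⟩
    · exact ⟨fun _ => p 0, fun h => absurd h hi⟩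
  choose g hg using this
  have hF : ∀ i, ∀ j < K, g ((i * K + j) / K) ((i * K + j) % K) = g i j := by
    intro i j hj
    rw [mul_comm, Nat.mul_add_div hK, Nat.div_eq_of_lt hj, Nat.mul_add_mod, Nat.mod_eq_of_lt hj,
      add_zero]
  refine ⟨fun t => g (t / K) (t % K), ?_, fun i hi => ?_, fun i hi v => ?_⟩
  · intro s hs t ht h
    beta_reduce at h
    have hs' : s / K < n := (Nat.div_lt_iff_lt_mul hK).2 hs
    have ht' : t / K < n := (Nat.div_lt_iff_lt_mul hK).2 ht
    have h1 : g (s / K) (s % K) ∈ D (s / K) :=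
      ((hg _ hs').2.2 _).2 ⟨_, Nat.mod_lt _ hK, rfl⟩
    have h2 : g (t / K) (t % K) ∈ D (t / K) :=
      ((hg _ ht').2.2 _).2 ⟨_, Nat.mod_lt _ hK, rfl⟩
    have heq : s / K = t / K := by
      by_contra hne
      exact Finset.disjoint_left.1 (hdis _ hs' _ ht' hne) h1 (h ▸ h2)
    have hmod : s % K = t % K := by
      refine (hg _ hs').2.1 (Nat.mod_lt _ hK) (Nat.mod_lt _ hK) ?_
      rw [h, heq]
    rw [← Nat.div_add_mod s K, ← Nat.div_add_mod t K, heq, hmod]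
  · have := hF i 0 hK
    rw [add_zero] at this
    beta_reduce
    rw [this, (hg i hi).1]
  · rw [(hg i hi).2.2]
    refine exists_congr fun j => and_congr_right fun hj => ?_
    beta_reduce
    rw [hF i j hj]

lemma copyIn_looseCycle [Fintype V] [DecidableEq V] {n : ℕ} {D : ℕ → Finset V} {p : ℕ → V}
    (hk : 2 ≤ k) (hn : 0 < n)
    (hD : ∀ i < n, (D i).card = k - 1) (hp : ∀ i < n, p i ∈ D i)
    (hdis : ∀ i < n, ∀ j < n, i ≠ j → Disjoint (D i) (D j)) (hpn : p n = p 0)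
    (hcard : ∀ i < n, (insert (p (i + 1)) (D i)).card = k)
    (hc : ∀ i < n, c (insert (p (i + 1)) (D i)) = b) :
    CopyIn k c b Finset.univ (looseCycle n k) := by
  obtain ⟨F, hF, hFp, hFD⟩ := exists_block_enum (by omega) hD hp hdis
  have hN : 0 < n * (k - 1) := Nat.mul_pos hn (by omega)
  have : NeZero (n * (k - 1)) := ⟨by omega⟩
  refine ⟨fun x => F x.val, ?_, fun _ _ => Finset.mem_univ _, ?_⟩
  · intro x _ y _ h
    exact ZMod.val_injective _ (hF (ZMod.val_lt x) (ZMod.val_lt y) h)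
  · rintro e ⟨i, hi, rfl⟩
    refine ⟨insert (p (i + 1)) (D i), hcard i hi, ?_, hc i hi⟩
    have hin : ∀ j < k - 1, i * (k - 1) + j < n * (k - 1) := fun j hj =>
      calc i * (k - 1) + j < (i + 1) * (k - 1) := by rw [add_mul]; omega
        _ ≤ n * (k - 1) := Nat.mul_le_mul_right _ hi
    have hlast : F (ZMod.val ((i * (k - 1) + (k - 1) : ℕ) : ZMod (n * (k - 1)))) = p (i + 1) := by
      rw [show i * (k - 1) + (k - 1) = (i + 1) * (k - 1) by ring, ZMod.val_natCast]
      rcases Nat.lt_or_ge (i + 1) n with h | h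
      · rw [Nat.mod_eq_of_lt (Nat.mul_lt_mul_of_pos_right h (by omega)), hFp _ h]
      · obtain rfl : n = i + 1 := by omega
        rw [Nat.mod_self, hpn, ← hFp 0 hn, zero_mul]
    ext v
    simp only [Finset.coe_insert, Set.mem_insert_iff, Finset.mem_coe, Set.mem_image,
      Set.mem_ofPred_eq, hFD i hi]
    constructor
    · rintro (rfl | ⟨j, hj, rfl⟩)
      · exact ⟨_, ⟨k - 1, by omega, rfl⟩, hlast⟩
      · refine ⟨_, ⟨j, by omega, rfl⟩, ?_⟩
        rw [ZMod.val_natCast, Nat.mod_eq_of_lt (hin j hj)]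
    · rintro ⟨_, ⟨j, hj, rfl⟩, rfl⟩
      rcases Nat.lt_or_ge j (k - 1) with h | h
      · refine .inr ⟨j, h, ?_⟩
        rw [ZMod.val_natCast, Nat.mod_eq_of_lt (hin j h)]
      · obtain rfl : j = k - 1 := by omega
        exact .inl hlast

lemma copyIn_loosePath [Fintype V] [DecidableEq V] {n : ℕ} {D : ℕ → Finset V} {p : ℕ → V}
    (hk : 2 ≤ k)
    (hD : ∀ i < n, (D i).card = k - 1) (hp : ∀ i < n, p i ∈ D i)
    (hdis : ∀ i < n, ∀ j < n, i ≠ j → Disjoint (D i) (D j)) (hpn : ∀ i < n, p n ∉ D i)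
    (hcard : ∀ i < n, (insert (p (i + 1)) (D i)).card = k)
    (hc : ∀ i < n, c (insert (p (i + 1)) (D i)) = b) :
    CopyIn k c b Finset.univ (loosePath n k) := by
  obtain ⟨F, hF, hFp, hFD⟩ := exists_block_enum (by omega) hD hp hdis
  have hne : ∀ t < n * (k - 1), F t ≠ p n := by
    intro t ht h
    have h1 : t / (k - 1) < n := (Nat.div_lt_iff_lt_mul (by omega)).2 ht
    refine hpn _ h1 (h ▸ (hFD _ h1 _).2 ⟨t % (k - 1), Nat.mod_lt _ (by omega), ?_⟩)
    rw [mul_comm, Nat.div_add_mod]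
  let F' : ℕ → V := fun t => if t < n * (k - 1) then F t else p n
  refine ⟨fun x => F' x, ?_, fun _ _ => Finset.mem_univ _, ?_⟩
  · intro x _ y _ h
    have hx := x.2
    have hy := y.2
    refine Fin.ext ?_
    simp only [F'] at h
    split_ifs at h with h1 h2 h2
    · exact hF h1 h2 h
    · exact absurd h (hne _ h1)
    · exact absurd h.symm (hne _ h2)
    · omega
  · rintro e ⟨i, hi, rfl⟩
    refine ⟨insert (p (i + 1)) (D i), hcard i hi, ?_, hc i hi⟩
    have hle : (i + 1) * (k - 1) ≤ n * (k - 1) := Nat.mul_le_mul_right _ hi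
    have hin : ∀ j < k - 1, i * (k - 1) + j < n * (k - 1) := fun j hj => by
      rw [add_mul] at hle; omega
    have hlast : F' (i * (k - 1) + (k - 1)) = p (i + 1) := by
      rw [show i * (k - 1) + (k - 1) = (i + 1) * (k - 1) by ring]
      rcases Nat.lt_or_ge (i + 1) n with h | h
      · simp only [F']
        rw [if_pos (Nat.mul_lt_mul_of_pos_right h (by omega)), hFp _ h]
      · obtain rfl : n = i + 1 := by omega
        simp [F']
    ext v
    simp only [Finset.coe_insert, Set.mem_insert_iff, Finset.mem_coe, Set.mem_image,
      Set.mem_ofPred_eq, hFD i hi]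
    constructor
    · rintro (rfl | ⟨j, hj, rfl⟩)
      · exact ⟨⟨i * (k - 1) + (k - 1), by rw [add_mul] at hle; omega⟩,
          ⟨k - 1, by omega, rfl⟩, hlast⟩
      · exact ⟨⟨i * (k - 1) + j, (hin j hj).trans (Nat.lt_succ_self _)⟩, ⟨j, by omega, rfl⟩,
          if_pos (hin j hj)⟩
    · rintro ⟨x, ⟨j, hj, hx⟩, rfl⟩
      rw [hx]
      rcases Nat.lt_or_ge j (k - 1) with h | h
      · exact .inr ⟨j, h, (if_pos (hin j h)).symm⟩
      · obtain rfl : j = k - 1 := by omega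
        exact .inl hlast

lemma copyIn_starUniform [Fintype V] [DecidableEq V] {n : ℕ} {D : ℕ → Finset V} {v : V}
    (hk : 2 ≤ k)
    (hD : ∀ i < n, (D i).card = k - 1)
    (hdis : ∀ i < n, ∀ j < n, i ≠ j → Disjoint (D i) (D j)) (hv : ∀ i < n, v ∉ D i)
    (hc : ∀ i < n, c (insert v (D i)) = b) :
    CopyIn k c b Finset.univ (starUniform n k) := by
  have : ∀ i, ∃ p, i < n → p ∈ D i := by
    intro i
    by_cases hi : i < n
    · obtain ⟨p, hp⟩ : (D i).Nonempty := Finset.card_pos.1 (by rw [hD i hi]; omega)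
      exact ⟨p, fun _ => hp⟩
    · exact ⟨v, fun h => absurd h hi⟩
  choose p hp using this
  obtain ⟨F, hF, -, hFD⟩ := exists_block_enum (by omega) hD hp hdis
  have hne : ∀ t < n * (k - 1), F t ≠ v := by
    intro t ht h
    have h1 : t / (k - 1) < n := (Nat.div_lt_iff_lt_mul (by omega)).2 ht
    refine hv _ h1 (h ▸ (hFD _ h1 _).2 ⟨t % (k - 1), Nat.mod_lt _ (by omega), ?_⟩)
    rw [mul_comm, Nat.div_add_mod]
  refine ⟨fun x => if (x : ℕ) = 0 then v else F (x - 1), ?_, fun _ _ => Finset.mem_univ _, ?_⟩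
  · intro x _ y _ h
    have hx := x.2
    have hy := y.2
    refine Fin.ext ?_
    simp only at h
    split_ifs at h with h1 h2 h2
    · omega
    · exact absurd h.symm (hne _ (by omega))
    · exact absurd h (hne _ (by omega))
    · have := hF (show (x : ℕ) - 1 < n * (k - 1) by omega)
        (show (y : ℕ) - 1 < n * (k - 1) by omega) h
      omega
  · rintro e ⟨i, hi, rfl⟩
    refine ⟨insert v (D i), by rw [Finset.card_insert_of_notMem (hv i hi), hD i hi]; omega, ?_,
      hc i hi⟩
    have hle : (i + 1) * (k - 1) ≤ n * (k - 1) := Nat.mul_le_mul_right _ hi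
    have hin : ∀ j < k - 1, i * (k - 1) + j < n * (k - 1) := fun j hj => by
      rw [add_mul] at hle; omega
    ext w
    simp only [Finset.coe_insert, Set.mem_insert_iff, Finset.mem_coe, Set.mem_image,
      Set.mem_ofPred_eq, hFD i hi]
    constructor
    · rintro (rfl | ⟨j, hj, rfl⟩)
      · exact ⟨0, .inl rfl, if_pos rfl⟩
      · have := hin j hj
        refine ⟨⟨i * (k - 1) + j + 1, by omega⟩, .inr ⟨j + 1, by omega, by omega, rfl⟩, ?_⟩
        rw [if_neg (by simp)]
        rfl
    · rintro ⟨x, hx, rfl⟩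
      by_cases h0 : (x : ℕ) = 0
      · exact .inl (if_pos h0)
      · obtain ⟨j, hj1, hj2, hj3⟩ := hx.resolve_left h0
        refine .inr ⟨j - 1, by omega, ?_⟩
        rw [if_neg h0]
        congr 1; omega

end Blocks

/-! ### Vertices and edges of the graphs; coloured configurations -/

section Graphs

variable {α : Type*} {k n : ℕ}

lemma two_le_ncard_of_forall_exists_notMem [Finite α] [Nonempty α] {H : Hypergraph α}
    (h : ∀ x, ∃ e ∈ H.edgeSet, x ∉ e) (T : Set α)
    (hT : ∀ e ∈ H.edgeSet, (e ∩ T).Nonempty) : 2 ≤ T.ncard := by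
  by_contra hlt
  have h1 : T.ncard ≤ 1 := by omega
  obtain ⟨x, hx⟩ := (Set.ncard_le_one_iff_subset_singleton (s := T)).1 h1
  obtain ⟨e, he, hxe⟩ := h x
  obtain ⟨y, hy, hyT⟩ := hT e he
  exact hxe (Set.mem_singleton_iff.1 (hx hyT) ▸ hy)

lemma one_le_ncard_of_nonempty [Finite α] {H : Hypergraph α} (h : H.edgeSet.Nonempty) (T : Set α)
    (hT : ∀ e ∈ H.edgeSet, (e ∩ T).Nonempty) : 1 ≤ T.ncard := by
  obtain ⟨e, he⟩ := h
  obtain ⟨x, -, hx⟩ := hT e he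
  exact (Set.ncard_pos (Set.toFinite T)).2 ⟨x, hx⟩

lemma ncard_vertexSet_looseCycle : (looseCycle n k).vertexSet.ncard = n * (k - 1) := by
  simp [looseCycle, Set.ncard_univ]

lemma ncard_vertexSet_loosePath : (loosePath n k).vertexSet.ncard = n * (k - 1) + 1 := by
  simp [loosePath, Set.ncard_univ]

lemma ncard_vertexSet_starUniform : (starUniform n k).vertexSet.ncard = n * (k - 1) + 1 := by
  simp [starUniform, Set.ncard_univ]

lemma not_isIsolated_looseCycle (hk : 2 ≤ k) (hn : 0 < n) (x : ZMod (n * (k - 1))) :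
    ¬ (looseCycle n k).IsIsolated x := by
  have : NeZero (n * (k - 1)) := ⟨(Nat.mul_pos hn (by omega)).ne'⟩
  intro h
  refine h _ ⟨x.val / (k - 1), (Nat.div_lt_iff_lt_mul (by omega)).2 (ZMod.val_lt x), rfl⟩
    ⟨x.val % (k - 1), (Nat.mod_lt _ (by omega)).trans (by omega), ?_⟩
  rw [Nat.div_add_mod', ZMod.natCast_zmod_val]

lemma not_isIsolated_loosePath (hk : 2 ≤ k) (hn : 0 < n) (x : Fin (n * (k - 1) + 1)) :
    ¬ (loosePath n k).IsIsolated x := by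
  intro h
  have hx := x.2
  rcases Nat.lt_or_ge x (n * (k - 1)) with hlt | hge
  · refine h _ ⟨x / (k - 1), (Nat.div_lt_iff_lt_mul (by omega)).2 hlt, rfl⟩
      ⟨x % (k - 1), (Nat.mod_lt _ (by omega)).trans (by omega), ?_⟩
    rw [Nat.div_add_mod']
  · obtain ⟨i, rfl⟩ : ∃ i, n = i + 1 := ⟨n - 1, by omega⟩
    refine h _ ⟨i, by omega, rfl⟩ ⟨k - 1, by omega, ?_⟩
    have := add_mul i 1 (k - 1)
    omega

lemma not_isIsolated_starUniform (hk : 2 ≤ k) (hn : 0 < n) (x : Fin (n * (k - 1) + 1)) :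
    ¬ (starUniform n k).IsIsolated x := by
  intro h
  have hx := x.2
  rcases Nat.eq_zero_or_pos x with h0 | hpos
  · exact h _ ⟨0, hn, rfl⟩ (.inl h0)
  · refine h _ ⟨(x - 1) / (k - 1), (Nat.div_lt_iff_lt_mul (by omega)).2 (by omega), rfl⟩
      (.inr ⟨(x - 1) % (k - 1) + 1, by omega, Nat.mod_lt _ (by omega), ?_⟩)
    rw [← add_assoc, Nat.div_add_mod']
    omega

lemma exists_notMem_looseCycle (hk : 2 ≤ k) (hn : 3 ≤ n) (x : ZMod (n * (k - 1))) :
    ∃ e ∈ (looseCycle n k).edgeSet, x ∉ e := by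
  have h3 : 3 * (k - 1) ≤ n * (k - 1) := Nat.mul_le_mul_right _ hn
  have : NeZero (n * (k - 1)) := ⟨by omega⟩
  have key : ∀ i < 3, (∀ j < k, x.val ≠ (i * (k - 1) + j) % (n * (k - 1))) →
      ∃ e ∈ (looseCycle n k).edgeSet, x ∉ e := by
    intro i hi h
    refine ⟨_, ⟨i, by omega, rfl⟩, ?_⟩
    rintro ⟨j, hj, rfl⟩
    exact h j hj (ZMod.val_natCast ..)
  rcases Nat.eq_zero_or_pos x.val with h0 | hpos
  · refine key 1 (by omega) fun j hj => ?_
    rw [Nat.mod_eq_of_lt (by omega)]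
    omega
  rcases Nat.lt_or_ge x.val k with hlt | hge
  · refine key 2 (by omega) fun j hj => ?_
    rcases Nat.lt_or_ge (2 * (k - 1) + j) (n * (k - 1)) with h | h
    · rw [Nat.mod_eq_of_lt h]
      omega
    · rw [show 2 * (k - 1) + j = n * (k - 1) by omega, Nat.mod_self]
      omega
  · refine key 0 (by omega) fun j hj => ?_
    rw [Nat.mod_eq_of_lt (by omega)]
    omega

lemma exists_notMem_loosePath (hk : 2 ≤ k) (hn : 3 ≤ n) (x : Fin (n * (k - 1) + 1)) :
    ∃ e ∈ (loosePath n k).edgeSet, x ∉ e := by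
  have key : ∀ i < 3, (∀ j < k, (x : ℕ) ≠ i * (k - 1) + j) →
      ∃ e ∈ (loosePath n k).edgeSet, x ∉ e := by
    intro i hi h
    refine ⟨_, ⟨i, by omega, rfl⟩, ?_⟩
    rintro ⟨j, hj, hx⟩
    exact h j hj hx
  rcases Nat.lt_or_ge x k with hlt | hge
  · exact key 2 (by omega) fun j hj => by omega
  · exact key 0 (by omega) fun j hj => by omega

end Graphs

section Configurations

variable {V W : Type*} [DecidableEq V] [DecidableEq W] {k : ℕ} {c : Finset V → Bool} {b : Bool}

/-- `e₁, e₂, e₃` are the edges of a `k`-uniform loose cycle with three edges. -/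
structure IsTri (k : ℕ) (e₁ e₂ e₃ : Finset V) : Prop where
  card₁ : e₁.card = k
  card₂ : e₂.card = k
  card₃ : e₃.card = k
  inter₁₂ : (e₁ ∩ e₂).card = 1
  inter₂₃ : (e₂ ∩ e₃).card = 1
  inter₃₁ : (e₃ ∩ e₁).card = 1
  disj : Disjoint (e₁ ∩ e₂) e₃

/-- `e₁, e₂, e₃, e₄` are the edges, in cyclic order, of a `k`-uniform loose cycle with four
edges. -/
structure IsQuad (k : ℕ) (e₁ e₂ e₃ e₄ : Finset V) : Prop where
  card₁ : e₁.card = k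
  card₂ : e₂.card = k
  card₃ : e₃.card = k
  card₄ : e₄.card = k
  inter₁₂ : (e₁ ∩ e₂).card = 1
  inter₂₃ : (e₂ ∩ e₃).card = 1
  inter₃₄ : (e₃ ∩ e₄).card = 1
  inter₄₁ : (e₄ ∩ e₁).card = 1
  disj₁₃ : Disjoint e₁ e₃
  disj₂₄ : Disjoint e₂ e₄

/-- `e₁, e₂, e₃` are the edges, in order, of a `k`-uniform loose path with three edges. -/
structure IsPath3 (k : ℕ) (e₁ e₂ e₃ : Finset V) : Prop where
  card₁ : e₁.card = k
  card₂ : e₂.card = k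
  card₃ : e₃.card = k
  inter₁₂ : (e₁ ∩ e₂).card = 1
  inter₂₃ : (e₂ ∩ e₃).card = 1
  disj₁₃ : Disjoint e₁ e₃

/-- `e₁, e₂, e₃, e₄` are the edges, in order, of a `k`-uniform loose path with four edges. -/
structure IsPath4 (k : ℕ) (e₁ e₂ e₃ e₄ : Finset V) : Prop where
  card₁ : e₁.card = k
  card₂ : e₂.card = k
  card₃ : e₃.card = k
  card₄ : e₄.card = k
  inter₁₂ : (e₁ ∩ e₂).card = 1
  inter₂₃ : (e₂ ∩ e₃).card = 1
  inter₃₄ : (e₃ ∩ e₄).card = 1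
  disj₁₃ : Disjoint e₁ e₃
  disj₂₄ : Disjoint e₂ e₄
  disj₁₄ : Disjoint e₁ e₄

/-- The colouring `c` has a loose triangle of colour `b`. -/
def MonoTri (k : ℕ) (c : Finset V → Bool) (b : Bool) : Prop :=
  ∃ e₁ e₂ e₃, IsTri k e₁ e₂ e₃ ∧ c e₁ = b ∧ c e₂ = b ∧ c e₃ = b

/-- The colouring `c` has a loose four-cycle of colour `b`. -/
def MonoQuad (k : ℕ) (c : Finset V → Bool) (b : Bool) : Prop :=
  ∃ e₁ e₂ e₃ e₄, IsQuad k e₁ e₂ e₃ e₄ ∧ c e₁ = b ∧ c e₂ = b ∧ c e₃ = b ∧ c e₄ = b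

/-- The colouring `c` has a loose path of colour `b` with three edges. -/
def MonoPath3 (k : ℕ) (c : Finset V → Bool) (b : Bool) : Prop :=
  ∃ e₁ e₂ e₃, IsPath3 k e₁ e₂ e₃ ∧ c e₁ = b ∧ c e₂ = b ∧ c e₃ = b

/-- The colouring `c` has a loose path of colour `b` with four edges. -/
def MonoPath4 (k : ℕ) (c : Finset V → Bool) (b : Bool) : Prop :=
  ∃ e₁ e₂ e₃ e₄, IsPath4 k e₁ e₂ e₃ e₄ ∧ c e₁ = b ∧ c e₂ = b ∧ c e₃ = b ∧ c e₄ = b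

/-- The colouring `c` has a star of colour `b` with three edges: they consist of a centre `v` and
pairwise disjoint sets `D₁, D₂, D₃`. -/
def MonoStar (k : ℕ) (c : Finset V → Bool) (b : Bool) : Prop :=
  ∃ (v : V) (D₁ D₂ D₃ : Finset V), D₁.card = k - 1 ∧ D₂.card = k - 1 ∧ D₃.card = k - 1 ∧
    v ∉ D₁ ∧ v ∉ D₂ ∧ v ∉ D₃ ∧ Disjoint D₁ D₂ ∧ Disjoint D₁ D₃ ∧ Disjoint D₂ D₃ ∧
    c (insert v D₁) = b ∧ c (insert v D₂) = b ∧ c (insert v D₃) = b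

lemma IsTri.map {e₁ e₂ e₃ : Finset W} (ι : W ↪ V) (h : IsTri k e₁ e₂ e₃) :
    IsTri k (e₁.map ι) (e₂.map ι) (e₃.map ι) := by
  obtain ⟨h₁, h₂, h₃, h₄, h₅, h₆, h₇⟩ := h
  constructor <;> simp only [Finset.card_map, ← Finset.map_inter, Finset.disjoint_map] <;> assumption

lemma IsQuad.map {e₁ e₂ e₃ e₄ : Finset W} (ι : W ↪ V) (h : IsQuad k e₁ e₂ e₃ e₄) :
    IsQuad k (e₁.map ι) (e₂.map ι) (e₃.map ι) (e₄.map ι) := by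
  obtain ⟨h₁, h₂, h₃, h₄, h₅, h₆, h₇, h₈, h₉, h₁₀⟩ := h
  constructor <;> simp only [Finset.card_map, ← Finset.map_inter, Finset.disjoint_map] <;> assumption

lemma MonoTri.map (ι : W ↪ V) (h : MonoTri k (fun e => c (e.map ι)) b) : MonoTri k c b := by
  obtain ⟨e₁, e₂, e₃, h, h'⟩ := h
  exact ⟨_, _, _, h.map ι, h'⟩

lemma MonoQuad.map (ι : W ↪ V) (h : MonoQuad k (fun e => c (e.map ι)) b) : MonoQuad k c b := by
  obtain ⟨e₁, e₂, e₃, e₄, h, h'⟩ := h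
  exact ⟨_, _, _, _, h.map ι, h'⟩

lemma mem_and_mem_iff_of_inter_eq {e f : Finset V} {p : V} (h : e ∩ f = {p}) (x : V) :
    x ∈ e ∧ x ∈ f ↔ x = p := by
  rw [← Finset.mem_inter, h, Finset.mem_singleton]

lemma MonoTri.copyIn [Fintype V] (hk : 2 ≤ k) (h : MonoTri k c b) :
    CopyIn k c b Finset.univ (looseCycle 3 k) := by
  obtain ⟨e₁, e₂, e₃, ⟨h₁, h₂, h₃, h₁₂, h₂₃, h₃₁, hd⟩, c₁, c₂, c₃⟩ := h
  obtain ⟨p, hp⟩ := Finset.card_eq_one.1 h₁₂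
  obtain ⟨q, hq⟩ := Finset.card_eq_one.1 h₂₃
  obtain ⟨r, hr⟩ := Finset.card_eq_one.1 h₃₁
  replace hp := mem_and_mem_iff_of_inter_eq hp
  replace hq := mem_and_mem_iff_of_inter_eq hq
  replace hr := mem_and_mem_iff_of_inter_eq hr
  rw [Finset.disjoint_left] at hd
  have hp' := (hp p).2 rfl
  have hq' := (hq q).2 rfl
  have hr' := (hr r).2 rfl
  have hpq : p ≠ q := by grind
  have hqr : q ≠ r := by grind
  have hrp : r ≠ p := by grind
  clear h₁₂ h₂₃ h₃₁
  refine copyIn_looseCycle (D := fun i => [e₁.erase p, e₂.erase q, e₃.erase r].getD i ∅)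
    (p := fun i => [r, p, q, r].getD i r) hk (by omega) ?_ ?_ ?_ rfl ?_ ?_
  · intro i hi
    interval_cases i <;> simp [*]
  · intro i hi
    interval_cases i <;> simp [*]
  · have d₁ : Disjoint (e₁.erase p) (e₂.erase q) := by rw [Finset.disjoint_left]; grind
    have d₂ : Disjoint (e₁.erase p) (e₃.erase r) := by rw [Finset.disjoint_left]; grind
    have d₃ : Disjoint (e₂.erase q) (e₃.erase r) := by rw [Finset.disjoint_left]; grind
    intro i hi j hj hij
    interval_cases i <;> interval_cases j <;>
      first | exact absurd rfl hij | assumption | (symm; assumption)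
  · intro i hi
    interval_cases i <;> simp [*, Finset.insert_erase]
  · intro i hi
    interval_cases i <;> simp [*, Finset.insert_erase]

lemma MonoQuad.copyIn [Fintype V] (hk : 2 ≤ k) (h : MonoQuad k c b) :
    CopyIn k c b Finset.univ (looseCycle 4 k) := by
  obtain ⟨e₁, e₂, e₃, e₄, ⟨h₁, h₂, h₃, h₄, h₁₂, h₂₃, h₃₄, h₄₁, hd, hd'⟩, c₁, c₂, c₃, c₄⟩ := h
  obtain ⟨p, hp⟩ := Finset.card_eq_one.1 h₁₂
  obtain ⟨q, hq⟩ := Finset.card_eq_one.1 h₂₃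
  obtain ⟨r, hr⟩ := Finset.card_eq_one.1 h₃₄
  obtain ⟨s, hs⟩ := Finset.card_eq_one.1 h₄₁
  replace hp := mem_and_mem_iff_of_inter_eq hp
  replace hq := mem_and_mem_iff_of_inter_eq hq
  replace hr := mem_and_mem_iff_of_inter_eq hr
  replace hs := mem_and_mem_iff_of_inter_eq hs
  rw [Finset.disjoint_left] at hd hd'
  have hp' := (hp p).2 rfl
  have hq' := (hq q).2 rfl
  have hr' := (hr r).2 rfl
  have hs' := (hs s).2 rfl
  clear h₁₂ h₂₃ h₃₄ h₄₁
  refine copyIn_looseCycle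
    (D := fun i => [e₁.erase p, e₂.erase q, e₃.erase r, e₄.erase s].getD i ∅)
    (p := fun i => [s, p, q, r, s].getD i s) hk (by omega) ?_ ?_ ?_ rfl ?_ ?_
  · intro i hi
    interval_cases i <;> simp [*]
  · have : p ≠ q := by grind
    have : q ≠ r := by grind
    have : r ≠ s := by grind
    have : s ≠ p := by grind
    intro i hi
    interval_cases i <;> simp [*]
  · have d₁ : Disjoint (e₁.erase p) (e₂.erase q) := by rw [Finset.disjoint_left]; grind
    have d₂ : Disjoint (e₂.erase q) (e₃.erase r) := by rw [Finset.disjoint_left]; grind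
    have d₃ : Disjoint (e₃.erase r) (e₄.erase s) := by rw [Finset.disjoint_left]; grind
    have d₄ : Disjoint (e₄.erase s) (e₁.erase p) := by rw [Finset.disjoint_left]; grind
    have d₅ : Disjoint (e₁.erase p) (e₃.erase r) := by rw [Finset.disjoint_left]; grind
    have d₆ : Disjoint (e₂.erase q) (e₄.erase s) := by rw [Finset.disjoint_left]; grind
    intro i hi j hj hij
    interval_cases i <;> interval_cases j <;>
      first | exact absurd rfl hij | assumption | (symm; assumption)
  · intro i hi
    interval_cases i <;> simp [*, Finset.insert_erase]
  · intro i hi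
    interval_cases i <;> simp [*, Finset.insert_erase]

lemma MonoPath3.copyIn [Fintype V] (hk : 2 ≤ k) (h : MonoPath3 k c b) :
    CopyIn k c b Finset.univ (loosePath 3 k) := by
  obtain ⟨e₁, e₂, e₃, ⟨h₁, h₂, h₃, h₁₂, h₂₃, hd⟩, c₁, c₂, c₃⟩ := h
  obtain ⟨p, hp⟩ := Finset.card_eq_one.1 h₁₂
  obtain ⟨q, hq⟩ := Finset.card_eq_one.1 h₂₃
  replace hp := mem_and_mem_iff_of_inter_eq hp
  replace hq := mem_and_mem_iff_of_inter_eq hq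
  obtain ⟨s, hs, hsp⟩ := Finset.exists_mem_ne (s := e₁) (by omega) p
  obtain ⟨r, hr, hrq⟩ := Finset.exists_mem_ne (s := e₃) (by omega) q
  rw [Finset.disjoint_left] at hd
  have hp' := (hp p).2 rfl
  have hq' := (hq q).2 rfl
  clear h₁₂ h₂₃
  refine copyIn_loosePath (D := fun i => [e₁.erase p, e₂.erase q, e₃.erase r].getD i ∅)
    (p := fun i => [s, p, q, r].getD i r) hk ?_ ?_ ?_ ?_ ?_ ?_
  · intro i hi
    interval_cases i <;> simp [*]
  · have : p ≠ q := by grind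
    intro i hi
    interval_cases i <;> simp [*, hrq.symm]
  · have d₁ : Disjoint (e₁.erase p) (e₂.erase q) := by rw [Finset.disjoint_left]; grind
    have d₂ : Disjoint (e₁.erase p) (e₃.erase r) := by rw [Finset.disjoint_left]; grind
    have d₃ : Disjoint (e₂.erase q) (e₃.erase r) := by rw [Finset.disjoint_left]; grind
    intro i hi j hj hij
    interval_cases i <;> interval_cases j <;>
      first | exact absurd rfl hij | assumption | (symm; assumption)
  · have : r ∉ e₁ := by grind
    have : r ∉ e₂ := by grind
    intro i hi
    interval_cases i <;> simp [*]
  · intro i hi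
    interval_cases i <;> simp [*, Finset.insert_erase]
  · intro i hi
    interval_cases i <;> simp [*, Finset.insert_erase]

lemma MonoPath4.copyIn [Fintype V] (hk : 2 ≤ k) (h : MonoPath4 k c b) :
    CopyIn k c b Finset.univ (loosePath 4 k) := by
  obtain ⟨e₁, e₂, e₃, e₄, ⟨h₁, h₂, h₃, h₄, h₁₂, h₂₃, h₃₄, hd, hd', hd''⟩, c₁, c₂, c₃, c₄⟩ := h
  obtain ⟨p, hp⟩ := Finset.card_eq_one.1 h₁₂
  obtain ⟨q, hq⟩ := Finset.card_eq_one.1 h₂₃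
  obtain ⟨r, hr⟩ := Finset.card_eq_one.1 h₃₄
  replace hp := mem_and_mem_iff_of_inter_eq hp
  replace hq := mem_and_mem_iff_of_inter_eq hq
  replace hr := mem_and_mem_iff_of_inter_eq hr
  obtain ⟨s, hs, hsp⟩ := Finset.exists_mem_ne (s := e₁) (by omega) p
  obtain ⟨t, ht, htr⟩ := Finset.exists_mem_ne (s := e₄) (by omega) r
  rw [Finset.disjoint_left] at hd hd' hd''
  have hp' := (hp p).2 rfl
  have hq' := (hq q).2 rfl
  have hr' := (hr r).2 rfl
  clear h₁₂ h₂₃ h₃₄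
  refine copyIn_loosePath
    (D := fun i => [e₁.erase p, e₂.erase q, e₃.erase r, e₄.erase t].getD i ∅)
    (p := fun i => [s, p, q, r, t].getD i s) hk ?_ ?_ ?_ ?_ ?_ ?_
  · intro i hi
    interval_cases i <;> simp [*]
  · have : p ≠ q := by grind
    have : q ≠ r := by grind
    intro i hi
    interval_cases i <;> simp [*, htr.symm]
  · have d₁ : Disjoint (e₁.erase p) (e₂.erase q) := by rw [Finset.disjoint_left]; grind
    have d₂ : Disjoint (e₂.erase q) (e₃.erase r) := by rw [Finset.disjoint_left]; grind
    have d₃ : Disjoint (e₃.erase r) (e₄.erase t) := by rw [Finset.disjoint_left]; grind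
    have d₄ : Disjoint (e₁.erase p) (e₄.erase t) := by rw [Finset.disjoint_left]; grind
    have d₅ : Disjoint (e₁.erase p) (e₃.erase r) := by rw [Finset.disjoint_left]; grind
    have d₆ : Disjoint (e₂.erase q) (e₄.erase t) := by rw [Finset.disjoint_left]; grind
    intro i hi j hj hij
    interval_cases i <;> interval_cases j <;>
      first | exact absurd rfl hij | assumption | (symm; assumption)
  · have : t ∉ e₁ := by grind
    have : t ∉ e₂ := by grind
    have : t ∉ e₃ := by grind
    intro i hi
    interval_cases i <;> simp [*]
  · intro i hi
    interval_cases i <;> simp [*, Finset.insert_erase]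
  · intro i hi
    interval_cases i <;> simp [*, Finset.insert_erase]

lemma MonoStar.copyIn [Fintype V] (hk : 2 ≤ k) (h : MonoStar k c b) :
    CopyIn k c b Finset.univ (starUniform 3 k) := by
  obtain ⟨v, D₁, D₂, D₃, h₁, h₂, h₃, n₁, n₂, n₃, d₁, d₂, d₃, c₁, c₂, c₃⟩ := h
  refine copyIn_starUniform (D := fun i => [D₁, D₂, D₃].getD i ∅) (v := v) hk ?_ ?_ ?_ ?_
  · intro i hi
    interval_cases i <;> simp [*]
  · intro i hi j hj hij
    interval_cases i <;> interval_cases j <;>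
      first | exact absurd rfl hij | assumption | (symm; assumption)
  · intro i hi
    interval_cases i <;> simp [*]
  · intro i hi
    interval_cases i <;> simp [*]

end Configurations

/-! ### Propagation of colours; triangles and stars on `3k - 2` vertices -/

section Exchange

variable {V : Type*} [DecidableEq V] {k : ℕ} {c : Finset V → Bool} {b : Bool}

/-- The Johnson graph is connected: a colouring of the `j`-subsets of `W` that is invariant under
exchanging one element is constant. -/
lemma eq_of_forall_exchange {W : Finset V} {j : ℕ} {F : Finset V → Bool}
    (h : ∀ A ⊆ W, A.card + 1 = j → ∀ x ∈ W, ∀ y ∈ W, x ∉ A → y ∉ A →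
      F (insert x A) = F (insert y A))
    {S T : Finset V} (hS : S ⊆ W) (hT : T ⊆ W) (hSj : S.card = j) (hTj : T.card = j) :
    F S = F T := by
  by_contra hne
  obtain ⟨A, hA, B, hB, ⟨hAj, hFA⟩, ⟨hBj, hFB⟩, hAB⟩ := exists_union_card_le (r := j) (S := W)
    (P := fun U => U.card = j ∧ F U = F S) (Q := fun U => U.card = j ∧ F U = F T)
    (fun U _ hU => by
      rcases h1 : F U <;> rcases h2 : F S <;> rcases h3 : F T <;> simp_all)
    hS hSj ⟨hSj, rfl⟩ hT hTj ⟨hTj, rfl⟩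
  have hne' : A ≠ B := fun h => hne (by rw [← hFA, ← hFB, h])
  have h1 := Finset.card_union_add_card_inter A B
  have h2 := Finset.card_sdiff_add_card_inter A B
  have h3 := Finset.card_sdiff_add_card_inter B A
  rw [Finset.inter_comm] at h3
  have h4 : (A \ B).card ≠ 0 := fun h0 => hne' (Finset.eq_of_subset_of_card_le
    (Finset.sdiff_eq_empty_iff_subset.1 (Finset.card_eq_zero.1 h0)) (by omega))
  obtain ⟨x, hx⟩ := Finset.card_eq_one.1 (show (A \ B).card = 1 by omega)
  obtain ⟨y, hy⟩ := Finset.card_eq_one.1 (show (B \ A).card = 1 by omega)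
  have hx' : ∀ z, z ∈ A ∧ z ∉ B ↔ z = x := fun z => by
    rw [← Finset.mem_sdiff, hx, Finset.mem_singleton]
  have hy' : ∀ z, z ∈ B ∧ z ∉ A ↔ z = y := fun z => by
    rw [← Finset.mem_sdiff, hy, Finset.mem_singleton]
  have hxA := (hx' x).2 rfl
  have hyB := (hy' y).2 rfl
  have hA' : insert x (A ∩ B) = A := by
    ext z; have := hx' z; simp only [Finset.mem_insert, Finset.mem_inter]; tauto
  have hB' : insert y (A ∩ B) = B := by
    ext z; have := hy' z; simp only [Finset.mem_insert, Finset.mem_inter]; tauto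
  have := h (A ∩ B) (Finset.inter_subset_left.trans hA) (by omega) x (hA hxA.1) y (hB hyB.1)
    (by simp [hxA]) (by simp [hyB])
  rw [hA', hB'] at this
  exact hne (by rw [← hFA, ← hFB, this])

/-- The property from which it follows that `c` is constant on `k`-sets: whenever `A ∪ {x}` and
`A ∪ {y}` have different colours, so do the sets `{a₁} ∪ D₁` and `{a₂} ∪ D₂`, for `a₁ ≠ a₂` in `A`
and for `D₁, D₂` with one common element and disjoint from `A ∪ {x, y}`. -/
def Propagates (k : ℕ) (c : Finset V → Bool) : Prop :=
  ∀ (A : Finset V) (x y : V), A.card = k - 1 → x ∉ A → y ∉ A → c (insert x A) ≠ c (insert y A) →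
    ∀ a₁ ∈ A, ∀ a₂ ∈ A, a₁ ≠ a₂ → ∀ D₁ D₂ : Finset V, D₁.card = k - 1 → D₂.card = k - 1 →
      (D₁ ∩ D₂).card = 1 → (∀ z ∈ D₁ ∪ D₂, z ∉ A ∧ z ≠ x ∧ z ≠ y) →
      c (insert a₁ D₁) ≠ c (insert a₂ D₂)

/-- If `A ∪ {x}` and `A ∪ {y}` have different colours, then so do `S ∪ {a}` and `S ∪ {a'}`, for
`a ≠ a'` in `A` and for every set `S` of `k - 1` elements outside `A ∪ {x, y}`. -/
lemma Propagates.ne [Fintype V] (hk : 3 ≤ k) (hV : Fintype.card V = 3 * k - 2)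
    (h : Propagates k c) {A : Finset V} {x y : V} (hA : A.card = k - 1) (hx : x ∉ A) (hy : y ∉ A)
    (hxy : c (insert x A) ≠ c (insert y A)) {a a' : V} (ha : a ∈ A) (ha' : a' ∈ A) (haa : a ≠ a')
    {S : Finset V} (hS : S.card = k - 1) (hSd : ∀ z ∈ S, z ∉ A ∧ z ≠ x ∧ z ≠ y) :
    c (insert a S) ≠ c (insert a' S) := by
  have hne : x ≠ y := fun h => hxy (by rw [h])
  set W := (insert x (insert y A))ᶜ with hW
  have hWc : W.card = 2 * k - 3 := by
    rw [hW, Finset.card_compl, Finset.card_insert_of_notMem (by simp [hne, hx]),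
      Finset.card_insert_of_notMem hy, hA, hV]
    omega
  have hWm : ∀ z ∈ W, z ∉ A ∧ z ≠ x ∧ z ≠ y := by
    intro z hz
    simp only [hW, Finset.mem_compl, Finset.mem_insert, not_or] at hz
    exact ⟨hz.2.2, hz.1, hz.2.1⟩
  -- `B ∪ {s}` and `W \ B` have size `k - 1` and the single element `s` in common
  have key : ∀ a₁ ∈ A, ∀ a₂ ∈ A, a₁ ≠ a₂ → ∀ B ⊆ W, B.card = k - 2 → ∀ s ∈ W, s ∉ B →
      c (insert a₁ (insert s B)) ≠ c (insert a₂ (W \ B)) := by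
    intro a₁ h₁ a₂ h₂ h₁₂ B hB hBc s hs hsB
    refine h A x y hA hx hy hxy a₁ h₁ a₂ h₂ h₁₂ _ _ ?_ ?_ ?_ ?_
    · rw [Finset.card_insert_of_notMem hsB, hBc]; omega
    · have := Finset.card_sdiff_add_card_eq_card hB
      omega
    · rw [Finset.card_eq_one]
      refine ⟨s, ?_⟩
      ext z
      simp only [Finset.mem_inter, Finset.mem_insert, Finset.mem_sdiff, Finset.mem_singleton]
      clear * - hs hsB
      grind
    · intro z hz
      refine hWm z ?_
      simp only [Finset.mem_union, Finset.mem_insert, Finset.mem_sdiff] at hz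
      rcases hz with (rfl | hz) | hz
      exacts [hs, hB hz, hz.1]
  have hSW : S ⊆ W := by
    intro z hz
    have := hSd z hz
    simp [hW, this]
  obtain ⟨s, hs⟩ : S.Nonempty := Finset.card_pos.1 (by omega)
  have hB : S.erase s ⊆ W := (Finset.erase_subset _ _).trans hSW
  have hBc : (S.erase s).card = k - 2 := by rw [Finset.card_erase_of_mem hs, hS]; omega
  have h1 := key a ha a' ha' haa _ hB hBc s (hSW hs) (Finset.notMem_erase _ _)
  rw [Finset.insert_erase hs] at h1
  have h2 : c (insert a' (W \ S.erase s)) = c (insert a' S) := by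
    refine eq_of_forall_exchange (F := fun T => c (insert a' T)) (W := W) (j := k - 1) ?_
      Finset.sdiff_subset hSW ?_ hS
    · intro B hB hBc u hu v hv huB hvB
      have e1 := key a' ha' a ha haa.symm B hB (by omega) u hu huB
      have e2 := key a' ha' a ha haa.symm B hB (by omega) v hv hvB
      exact (by decide : ∀ p q r : Bool, p ≠ r → q ≠ r → p = q) _ _ _ e1 e2
    · have := Finset.card_sdiff_add_card_eq_card hB
      omega
  rwa [h2] at h1

lemma Propagates.eq [Fintype V] (hk : 3 ≤ k) (hV : Fintype.card V = 3 * k - 2)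
    (h : Propagates k c) {e f : Finset V} (he : e.card = k) (hf : f.card = k) : c e = c f := by
  refine eq_of_forall_exchange (W := Finset.univ) ?_ (Finset.subset_univ _)
    (Finset.subset_univ _) he hf
  intro A _ hA x _ y _ hx hy
  by_contra hxy
  replace hA : A.card = k - 1 := by omega
  have hne : x ≠ y := fun h => hxy (by rw [h])
  obtain ⟨a, ha, a', ha', haa⟩ := Finset.one_lt_card.1 (show 1 < A.card by omega)
  set S₀ := insert x (insert y ((A.erase a).erase a')) with hS₀
  have hS₀c : S₀.card = k - 1 := by
    rw [hS₀, Finset.card_insert_of_notMem (by simp [hne, hx]),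
      Finset.card_insert_of_notMem (by simp [hy]),
      Finset.card_erase_of_mem (by simp [ha', haa.symm]), Finset.card_erase_of_mem ha]
    omega
  set W := (insert x (insert y A))ᶜ with hW
  have hWc : W.card = 2 * k - 3 := by
    rw [hW, Finset.card_compl, Finset.card_insert_of_notMem (by simp [hne, hx]),
      Finset.card_insert_of_notMem hy, hA, hV]
    omega
  have hWm : ∀ z ∈ W, z ∉ A ∧ z ≠ x ∧ z ≠ y := by
    intro z hz
    simp only [hW, Finset.mem_compl, Finset.mem_insert, not_or] at hz
    exact ⟨hz.2.2, hz.1, hz.2.1⟩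
  -- every `(k - 1)`-subset of `W` is again bichromatic, which constrains the sets `{s} ∪ S₀`
  have key : ∀ s ∈ W, ∀ s' ∈ W, s ≠ s' → c (insert s S₀) ≠ c (insert s' S₀) := by
    intro s hs s' hs' hss
    obtain ⟨S, hsS, hSW, hSc⟩ := Finset.exists_subsuperset_card_eq (s := {s, s'}) (t := W)
      (n := k - 1) (by simp [Finset.insert_subset_iff, hs, hs'])
      (by rw [Finset.card_pair hss]; omega) (by omega)
    have hS : c (insert a S) ≠ c (insert a' S) :=
      h.ne hk hV hA hx hy hxy ha ha' haa hSc fun z hz => hWm z (hSW hz)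
    have haS : ∀ z ∈ A, z ∉ S := fun z hz hzS => (hWm z (hSW hzS)).1 hz
    refine h.ne hk hV hSc (haS a ha) (haS a' ha') hS (hsS (by simp)) (hsS (by simp)) hss hS₀c ?_
    intro z hz
    have hxS : x ∉ S := fun hxS => (hWm x (hSW hxS)).2.1 rfl
    have hyS : y ∉ S := fun hyS => (hWm y (hSW hyS)).2.2 rfl
    simp only [hS₀, Finset.mem_insert, Finset.mem_erase] at hz
    clear * - hz hxS hyS haS hx hy ha ha'
    grind
  obtain ⟨s₁, s₂, s₃, h₁, h₂, h₃, h₁₂, h₁₃, h₂₃⟩ :=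
    Finset.two_lt_card_iff.1 (show 2 < W.card by omega)
  exact (by decide : ∀ p q r : Bool, p ≠ q → p ≠ r → q ≠ r → False) _ _ _
    (key _ h₁ _ h₂ h₁₂) (key _ h₁ _ h₃ h₁₃) (key _ h₂ _ h₃ h₂₃)

/-- The edge of the right colour among `A ∪ {x}` and `A ∪ {y}` would close `{a₁} ∪ D₁` and `{a₂} ∪ D₂`
to a monochromatic triangle. -/
lemma propagates_of_not_monoTri (hk : 3 ≤ k) (h : ∀ b, ¬ MonoTri k c b) : Propagates k c := by
  intro A x y hA hx hy hxy a₁ h₁ a₂ h₂ h₁₂ D₁ D₂ hD₁ hD₂ hD hz heq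
  obtain ⟨z, hzA, hcz, hzD⟩ : ∃ z, z ∉ A ∧ c (insert z A) = c (insert a₁ D₁) ∧
      ∀ w ∈ D₁ ∪ D₂, w ∉ A ∧ w ≠ z := by
    by_cases hc : c (insert x A) = c (insert a₁ D₁)
    · exact ⟨x, hx, hc, fun w hw => ⟨(hz w hw).1, (hz w hw).2.1⟩⟩
    · refine ⟨y, hy, ?_, fun w hw => ⟨(hz w hw).1, (hz w hw).2.2⟩⟩
      cases h3 : c (insert a₁ D₁) <;> simp_all
  refine h _ ⟨insert z A, insert a₁ D₁, insert a₂ D₂, ⟨?_, ?_, ?_, ?_, ?_, ?_, ?_⟩, hcz, rfl,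
    heq.symm⟩
  all_goals clear heq hxy hcz hz h
  · rw [Finset.card_insert_of_notMem hzA]; omega
  · rw [Finset.card_insert_of_notMem (by grind)]; omega
  · rw [Finset.card_insert_of_notMem (by grind)]; omega
  · rw [Finset.card_eq_one]; exact ⟨a₁, by ext w; grind⟩
  · rw [← hD]; congr 1; ext w; simp only [Finset.mem_inter, Finset.mem_insert]; grind
  · rw [Finset.card_eq_one]; exact ⟨a₂, by ext w; grind⟩
  · rw [Finset.disjoint_left]; intro w; simp only [Finset.mem_inter, Finset.mem_insert]; grind

/-- With `w` the common element of `D₁` and `D₂`, the absence of stars centred at `a₁`, `a₂` and `y`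
forces the colours of further edges, until there is a monochromatic star centred at `w`. -/
lemma propagates_of_not_monoStar (hk : 3 ≤ k) (h : ∀ b, ¬ MonoStar k c b) : Propagates k c := by
  -- `x` is the element for which `A ∪ {x}` has the colour of `{a₁} ∪ D₁`
  have key : ∀ (A : Finset V) (x y : V), A.card = k - 1 → x ∉ A → y ∉ A →
      ∀ a₁ ∈ A, ∀ a₂ ∈ A, a₁ ≠ a₂ → ∀ D₁ D₂ : Finset V, D₁.card = k - 1 → D₂.card = k - 1 →
      (D₁ ∩ D₂).card = 1 → (∀ z ∈ D₁ ∪ D₂, z ∉ A ∧ z ≠ x ∧ z ≠ y) → x ≠ y → ∀ γ : Bool,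
      c (insert x A) = γ → c (insert a₁ D₁) = γ → c (insert a₂ D₂) = γ → False := by
    intro A x y hA hx hy a₁ h₁ a₂ h₂ h₁₂ D₁ D₂ hD₁ hD₂ hD hz hxy γ hcx hc₁ hc₂
    obtain ⟨w, hw⟩ := Finset.card_eq_one.1 hD
    replace hw := mem_and_mem_iff_of_inter_eq hw
    have hw' := (hw w).2 rfl
    have hAc : ((A.erase a₁).erase a₂).card = k - 3 := by
      rw [Finset.card_erase_of_mem (by simp [h₂, h₁₂.symm]), Finset.card_erase_of_mem h₁]
      omega
    have hstar := h γ
    have hstar' := h (!γ)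
    have e₁ : c (insert a₁ (insert y (D₂.erase w))) = !γ := by
      by_contra hcon
      refine hstar ⟨a₁, insert x (A.erase a₁), D₁, insert y (D₂.erase w), ?_, hD₁, ?_, ?_, ?_, ?_,
        ?_, ?_, ?_, ?_, hc₁, by simpa using hcon⟩
      all_goals clear h hstar hstar' hcon
      · rw [Finset.card_insert_of_notMem (by simp [hx]), Finset.card_erase_of_mem h₁]; omega
      · rw [Finset.card_insert_of_notMem (by grind), Finset.card_erase_of_mem hw'.2]; omega
      · grind
      · grind
      · grind
      · rw [Finset.disjoint_left]; grind
      · rw [Finset.disjoint_left]; grind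
      · rw [Finset.disjoint_left]; grind
      · rw [Finset.insert_comm, Finset.insert_erase h₁, hcx]
    have e₂ : c (insert a₂ (insert y (D₁.erase w))) = !γ := by
      by_contra hcon
      refine hstar ⟨a₂, insert x (A.erase a₂), D₂, insert y (D₁.erase w), ?_, hD₂, ?_, ?_, ?_, ?_,
        ?_, ?_, ?_, ?_, hc₂, by simpa using hcon⟩
      all_goals clear h hstar hstar' hcon
      · rw [Finset.card_insert_of_notMem (by simp [hx]), Finset.card_erase_of_mem h₂]; omega
      · rw [Finset.card_insert_of_notMem (by grind), Finset.card_erase_of_mem hw'.1]; omega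
      · grind
      · grind
      · grind
      · rw [Finset.disjoint_left]; grind
      · rw [Finset.disjoint_left]; grind
      · rw [Finset.disjoint_left]; grind
      · rw [Finset.insert_comm, Finset.insert_erase h₂, hcx]
    have e₃ : c (insert y (insert x (insert w ((A.erase a₁).erase a₂)))) = γ := by
      by_contra hcon
      refine hstar' ⟨y, insert a₁ (D₂.erase w), insert a₂ (D₁.erase w),
        insert x (insert w ((A.erase a₁).erase a₂)), ?_, ?_, ?_, ?_, ?_, ?_, ?_, ?_, ?_,
        by rw [Finset.insert_comm]; exact e₁, by rw [Finset.insert_comm]; exact e₂,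
        Bool.eq_not.2 hcon⟩
      all_goals clear h hstar hstar' hcon e₁ e₂ hcx hc₁ hc₂
      · rw [Finset.card_insert_of_notMem (by grind), Finset.card_erase_of_mem hw'.2]; omega
      · rw [Finset.card_insert_of_notMem (by grind), Finset.card_erase_of_mem hw'.1]; omega
      · rw [Finset.card_insert_of_notMem (by grind), Finset.card_insert_of_notMem (by grind)]; omega
      · grind
      · grind
      · grind
      · rw [Finset.disjoint_left]; grind
      · rw [Finset.disjoint_left]; grind
      · rw [Finset.disjoint_left]; grind
    refine hstar ⟨w, insert a₁ (D₁.erase w), insert a₂ (D₂.erase w),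
      insert x (insert y ((A.erase a₁).erase a₂)), ?_, ?_, ?_, ?_, ?_, ?_, ?_, ?_, ?_, ?_, ?_, ?_⟩
    all_goals clear h hstar hstar' e₁ e₂ hcx
    · rw [Finset.card_insert_of_notMem (by grind), Finset.card_erase_of_mem hw'.1]; omega
    · rw [Finset.card_insert_of_notMem (by grind), Finset.card_erase_of_mem hw'.2]; omega
    · rw [Finset.card_insert_of_notMem (by grind), Finset.card_insert_of_notMem (by grind)]; omega
    · grind
    · grind
    · grind
    · rw [Finset.disjoint_left]; grind
    · rw [Finset.disjoint_left]; grind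
    · rw [Finset.disjoint_left]; grind
    · rw [Finset.insert_comm, Finset.insert_erase hw'.1, hc₁]
    · rw [Finset.insert_comm, Finset.insert_erase hw'.2, hc₂]
    · rw [← e₃]; congr 1; ext z; simp only [Finset.mem_insert]; tauto
  intro A x y hA hx hy hxy a₁ h₁ a₂ h₂ h₁₂ D₁ D₂ hD₁ hD₂ hD hz heq
  have hne : x ≠ y := fun h => hxy (by rw [h])
  by_cases hc : c (insert x A) = c (insert a₁ D₁)
  · exact key A x y hA hx hy a₁ h₁ a₂ h₂ h₁₂ D₁ D₂ hD₁ hD₂ hD hz hne _ hc rfl heq.symm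
  · refine key A y x hA hy hx a₁ h₁ a₂ h₂ h₁₂ D₁ D₂ hD₁ hD₂ hD
      (fun z h => ⟨(hz z h).1, (hz z h).2.2, (hz z h).2.1⟩) hne.symm _ ?_ rfl heq.symm
    cases h3 : c (insert a₁ D₁) <;> simp_all

lemma exists_three_disjoint {U : Finset V} {j : ℕ} (hU : 3 * j ≤ U.card) :
    ∃ X ⊆ U, ∃ Y ⊆ U, ∃ Z ⊆ U, X.card = j ∧ Y.card = j ∧ Z.card = j ∧
      Disjoint X Y ∧ Disjoint X Z ∧ Disjoint Y Z := by
  obtain ⟨X, hX, hXj⟩ := Finset.exists_subset_card_eq (s := U) (n := j) (by omega)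
  have h1 := Finset.card_sdiff_add_card_eq_card hX
  obtain ⟨Y, hY, hYj⟩ := Finset.exists_subset_card_eq (s := U \ X) (n := j) (by omega)
  have h2 := Finset.card_sdiff_add_card_eq_card hY
  obtain ⟨Z, hZ, hZj⟩ := Finset.exists_subset_card_eq (s := (U \ X) \ Y) (n := j) (by omega)
  simp only [Finset.subset_iff, Finset.mem_sdiff, Finset.disjoint_left] at *
  exact ⟨X, hX, Y, fun z hz => (hY hz).1, Z, fun z hz => (hZ hz).1.1, hXj, hYj, hZj,
    fun z hz hz' => (hY hz').2 hz, fun z hz hz' => (hZ hz').1.2 hz, fun z hz hz' => (hZ hz').2 hz⟩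

theorem exists_monoTri [Fintype V] (hk : 3 ≤ k) (hV : Fintype.card V = 3 * k - 2)
    (c : Finset V → Bool) : ∃ b, MonoTri k c b := by
  by_contra! h
  have hc {e f : Finset V} := (propagates_of_not_monoTri hk h).eq (e := e) (f := f) hk hV
  obtain ⟨X, -, Y, -, Z, -, hX, hY, hZ, hXY, hXZ, hYZ⟩ := exists_three_disjoint (j := k - 1)
    (U := (Finset.univ : Finset V)) (by rw [Finset.card_univ]; omega)
  obtain ⟨p, hp⟩ : X.Nonempty := Finset.card_pos.1 (by omega)
  obtain ⟨q, hq⟩ : Y.Nonempty := Finset.card_pos.1 (by omega)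
  obtain ⟨r, hr⟩ : Z.Nonempty := Finset.card_pos.1 (by omega)
  rw [Finset.disjoint_left] at hXY hXZ hYZ
  have h₁ : (insert q X).card = k := by rw [Finset.card_insert_of_notMem (by grind)]; omega
  have h₂ : (insert r Y).card = k := by rw [Finset.card_insert_of_notMem (by grind)]; omega
  have h₃ : (insert p Z).card = k := by rw [Finset.card_insert_of_notMem (by grind)]; omega
  refine h _ ⟨insert q X, insert r Y, insert p Z, ⟨h₁, h₂, h₃, ?_, ?_, ?_, ?_⟩, rfl,
    hc h₂ h₁, hc h₃ h₁⟩
  · exact Finset.card_eq_one.2 ⟨q, by ext w; grind⟩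
  · exact Finset.card_eq_one.2 ⟨r, by ext w; grind⟩
  · exact Finset.card_eq_one.2 ⟨p, by ext w; grind⟩
  · rw [Finset.disjoint_left]; grind

theorem exists_monoStar [Fintype V] (hk : 3 ≤ k) (hV : Fintype.card V = 3 * k - 2)
    (c : Finset V → Bool) : ∃ b, MonoStar k c b := by
  by_contra! h
  have hc {e f : Finset V} := (propagates_of_not_monoStar hk h).eq (e := e) (f := f) hk hV
  obtain ⟨v⟩ : Nonempty V := Fintype.card_pos_iff.1 (by omega)
  obtain ⟨X, hX', Y, hY', Z, hZ', hX, hY, hZ, hXY, hXZ, hYZ⟩ := exists_three_disjoint (j := k - 1)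
    (U := (Finset.univ : Finset V).erase v)
    (by rw [Finset.card_erase_of_mem (Finset.mem_univ _), Finset.card_univ]; omega)
  have nX : v ∉ X := fun h => by simpa using hX' h
  have nY : v ∉ Y := fun h => by simpa using hY' h
  have nZ : v ∉ Z := fun h => by simpa using hZ' h
  have h₁ : (insert v X).card = k := by rw [Finset.card_insert_of_notMem nX]; omega
  have h₂ : (insert v Y).card = k := by rw [Finset.card_insert_of_notMem nY]; omega
  have h₃ : (insert v Z).card = k := by rw [Finset.card_insert_of_notMem nZ]; omega
  exact h _ ⟨v, X, Y, Z, hX, hY, hZ, nX, nY, nZ, hXY, hXZ, hYZ, rfl, hc h₂ h₁, hc h₃ h₁⟩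

end Exchange

/-! ### The crossing lemma for colourings without monochromatic four-cycles -/

section Crossing

variable {V : Type*} [DecidableEq V] {k : ℕ} {c : Finset V → Bool} {b : Bool}

/-- In a colouring of a `(4k - 3)`-set without monochromatic loose four-cycle, exchanging `x` for
`y` cannot turn a red edge `A ∪ {x}` blue and a blue edge `A' ∪ {x}` red, for disjoint `A, A'`. -/
lemma not_crossing [Fintype V] (hk : 3 ≤ k) (hV : Fintype.card V = 4 * k - 3)
    (h : ∀ b, ¬ MonoQuad k c b) {A A' : Finset V} {x y : V} (hA : A.card = k - 1)
    (hA' : A'.card = k - 1) (hAA : Disjoint A A') (hx : x ∉ A) (hx' : x ∉ A') (hy : y ∉ A)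
    (hy' : y ∉ A') (c₁ : c (insert x A) = true) (c₂ : c (insert y A) = false)
    (c₃ : c (insert x A') = false) (c₄ : c (insert y A') = true) : False := by
  have hxy : x ≠ y := by rintro rfl; simp [c₁] at c₂
  obtain ⟨a₁, ha₁, a₂, ha₂, ha⟩ := Finset.one_lt_card.1 (show 1 < A.card by omega)
  obtain ⟨b₁, hb₁, b₂, hb₂, hb⟩ := Finset.one_lt_card.1 (show 1 < A'.card by omega)
  rw [Finset.disjoint_left] at hAA
  set D := (insert x (insert y (A ∪ A')))ᶜ with hD
  have hDc : D.card = 2 * k - 3 := by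
    rw [hD, Finset.card_compl, Finset.card_insert_of_notMem (by simp [*]),
      Finset.card_insert_of_notMem (by simp [*]),
      Finset.card_union_of_disjoint (Finset.disjoint_left.2 hAA), hA, hA', hV]
    omega
  have hDm : ∀ z ∈ D, z ∉ A ∧ z ∉ A' ∧ z ≠ x ∧ z ≠ y := by
    intro z hz
    simp only [hD, Finset.mem_compl, Finset.mem_insert, Finset.mem_union, not_or] at hz
    exact ⟨hz.2.2.1, hz.2.2.2, hz.1, hz.2.1⟩
  have cAx : (insert x A).card = k := by rw [Finset.card_insert_of_notMem hx]; omega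
  have cAy : (insert y A).card = k := by rw [Finset.card_insert_of_notMem hy]; omega
  have cAx' : (insert x A').card = k := by rw [Finset.card_insert_of_notMem hx']; omega
  have cAy' : (insert y A').card = k := by rw [Finset.card_insert_of_notMem hy']; omega
  -- opposite edges of a four-cycle can be `A ∪ {x}, A' ∪ {y}` (red) or `A ∪ {y}, A' ∪ {x}` (blue)
  have key : ∀ p q p' q' : V, p ∉ A' → q ∉ A → p' ∉ A' → q' ∉ A → p ≠ p' → q ≠ q' →
      p ∈ A → q ∈ A' → (p' ∈ A ∧ q' ∈ A' ∨ p' = x ∧ q' = y) →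
      ∀ Y ⊆ D, ∀ Z ⊆ D, Y.card = k - 2 → Z.card = k - 2 → Disjoint Y Z →
      c (insert p (insert q Y)) ≠ c (insert p' (insert q' Z)) := by
    intro p q p' q' hp hq hp' hq' hpp hqq hpA hqA hor Y hY Z hZ hYc hZc hYZ heq
    rw [Finset.disjoint_left] at hYZ
    have hY' : ∀ z ∈ Y, z ∉ A ∧ z ∉ A' ∧ z ≠ x ∧ z ≠ y := fun z hz => hDm z (hY hz)
    have hZ' : ∀ z ∈ Z, z ∉ A ∧ z ∉ A' ∧ z ≠ x ∧ z ≠ y := fun z hz => hDm z (hZ hz)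
    clear hDm hD
    have d₁ : (insert p (insert q Y)).card = k := by
      rw [Finset.card_insert_of_notMem (by grind), Finset.card_insert_of_notMem (by grind)]; omega
    have d₂ : (insert p' (insert q' Z)).card = k := by
      rw [Finset.card_insert_of_notMem (by grind), Finset.card_insert_of_notMem (by grind)]; omega
    have d₃ : Disjoint (insert p (insert q Y)) (insert p' (insert q' Z)) := by
      rw [Finset.disjoint_left]; grind
    cases hc : c (insert p (insert q Y)) with
    | true =>
      refine h _ ⟨insert x A, insert p (insert q Y), insert y A', insert p' (insert q' Z),
        ⟨cAx, d₁, cAy', d₂, ?_, ?_, ?_, ?_, ?_, d₃⟩, c₁, hc, c₄, heq ▸ hc⟩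
      all_goals clear h d₁ d₂ d₃ heq hc cAx cAy cAx' cAy' c₁ c₂ c₃ c₄
      · exact Finset.card_eq_one.2 ⟨p, by ext w; grind⟩
      · exact Finset.card_eq_one.2 ⟨q, by ext w; grind⟩
      · exact Finset.card_eq_one.2 ⟨q', by ext w; grind⟩
      · exact Finset.card_eq_one.2 ⟨p', by ext w; grind⟩
      · rw [Finset.disjoint_left]; grind
    | false =>
      refine h _ ⟨insert y A, insert p (insert q Y), insert x A', insert p' (insert q' Z),
        ⟨cAy, d₁, cAx', d₂, ?_, ?_, ?_, ?_, ?_, d₃⟩, c₂, hc, c₃, heq ▸ hc⟩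
      all_goals clear h d₁ d₂ d₃ heq hc cAx cAy cAx' cAy' c₁ c₂ c₃ c₄
      · exact Finset.card_eq_one.2 ⟨p, by ext w; grind⟩
      · exact Finset.card_eq_one.2 ⟨q, by ext w; grind⟩
      · rcases hor with hor | hor
        · exact Finset.card_eq_one.2 ⟨q', by ext w; grind⟩
        · exact Finset.card_eq_one.2 ⟨p', by ext w; grind⟩
      · rcases hor with hor | hor
        · exact Finset.card_eq_one.2 ⟨p', by ext w; grind⟩
        · exact Finset.card_eq_one.2 ⟨q', by ext w; grind⟩
      · rw [Finset.disjoint_left]; grind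
  have na₁ : a₁ ∉ A' := hAA ha₁
  have na₂ : a₂ ∉ A' := hAA ha₂
  have nb₁ : b₁ ∉ A := fun h => hAA h hb₁
  have nb₂ : b₂ ∉ A := fun h => hAA h hb₂
  have k₁₂ := key a₁ b₁ a₂ b₂ na₁ nb₁ na₂ nb₂ ha hb ha₁ hb₁ (.inl ⟨ha₂, hb₂⟩)
  have k₁₃ := key a₁ b₁ x y na₁ nb₁ hx' hy (by grind) (by grind) ha₁ hb₁ (.inr ⟨rfl, rfl⟩)
  have k₂₃ := key a₂ b₂ x y na₂ nb₂ hx' hy (by grind) (by grind) ha₂ hb₂ (.inr ⟨rfl, rfl⟩)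
  obtain ⟨Y, hY, hYc⟩ := Finset.exists_subset_card_eq (s := D) (n := k - 2) (by omega)
  have hDY := Finset.card_sdiff_add_card_eq_card hY
  obtain ⟨Z, hZ, hZc⟩ := Finset.exists_subset_card_eq (s := D \ Y) (n := k - 2) (by omega)
  have hZD := hZ.trans Finset.sdiff_subset
  have hYZ : Disjoint Y Z := Finset.disjoint_of_subset_right hZ Finset.disjoint_sdiff
  have hconst : c (insert a₁ (insert b₁ Y)) = c (insert a₁ (insert b₁ Z)) := by
    refine eq_of_forall_exchange (F := fun Y => c (insert a₁ (insert b₁ Y))) (W := D) ?_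
      hY hZD hYc hZc
    intro B hB hBc u hu v hv huB hvB
    have huvB : insert u (insert v B) ⊆ D := by simp [Finset.insert_subset_iff, hu, hv, hB]
    have h1 := Finset.card_sdiff_add_card_eq_card huvB
    have h2 := Finset.card_insert_le u (insert v B)
    have h3 := Finset.card_insert_le v B
    obtain ⟨T, hT, hTc⟩ := Finset.exists_subset_card_eq (s := D \ insert u (insert v B))
      (n := k - 2) (by omega)
    have hTD := hT.trans Finset.sdiff_subset
    have hTd : Disjoint (insert u (insert v B)) T :=
      Finset.disjoint_of_subset_right hT Finset.disjoint_sdiff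
    have e₁ := k₁₂ (insert u B) (Finset.insert_subset hu hB) T hTD
      (by rw [Finset.card_insert_of_notMem huB]; omega) hTc
      (Finset.disjoint_of_subset_left (Finset.insert_subset_insert _ (Finset.subset_insert _ _)) hTd)
    have e₂ := k₁₂ (insert v B) (Finset.insert_subset hv hB) T hTD
      (by rw [Finset.card_insert_of_notMem hvB]; omega) hTc
      (Finset.disjoint_of_subset_left (Finset.subset_insert _ _) hTd)
    exact (by decide : ∀ p q r : Bool, p ≠ r → q ≠ r → p = q) _ _ _ e₁ e₂
  have e₁₂ := k₁₂ Y hY Z hZD hYc hZc hYZ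
  have e₂₃ := k₂₃ Z hZD Y hY hZc hYc hYZ.symm
  have e₁₃ := k₁₃ Z hZD Y hY hZc hYc hYZ.symm
  rw [← hconst] at e₁₃
  exact (by decide : ∀ p q r : Bool, p ≠ q → p ≠ r → q ≠ r → False) _ _ _ e₁₂ e₁₃ e₂₃

end Crossing

/-! ### Shifting; four-cycles on `4k - 3` vertices -/

section Shift

variable {V : Type*} [DecidableEq V] {k : ℕ} {c : Finset V → Bool} {b : Bool}

/-- The image of `e` under the transposition of `x` and `y`. -/
def swapSet (x y : V) (e : Finset V) : Finset V := e.map (Equiv.swap x y).toEmbedding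

lemma swapSet_insert {x y : V} {A : Finset V} (hx : x ∉ A) (hy : y ∉ A) :
    swapSet x y (insert x A) = insert y A := by
  ext z
  rw [swapSet, Finset.mem_map_equiv, Equiv.symm_swap]
  rcases eq_or_ne z x with rfl | hzx
  · simp [hx, hy, eq_comm]
  rcases eq_or_ne z y with rfl | hzy
  · simp
  rw [Equiv.swap_apply_of_ne_of_ne hzx hzy]
  simp [hzx, hzy]

lemma swapSet_comm (x y : V) (e : Finset V) : swapSet x y e = swapSet y x e := by
  rw [swapSet, swapSet, Equiv.swap_comm]

lemma swapSet_swapSet (x y : V) (e : Finset V) : swapSet x y (swapSet x y e) = e := by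
  ext z
  simp [swapSet, Finset.mem_map_equiv]

lemma swapSet_eq_self {x y : V} {e : Finset V} (h : x ∈ e ↔ y ∈ e) : swapSet x y e = e := by
  ext z
  rw [swapSet, Finset.mem_map_equiv, Equiv.symm_swap]
  rcases eq_or_ne z x with rfl | hzx
  · simp [h]
  rcases eq_or_ne z y with rfl | hzy
  · simp [h]
  rw [Equiv.swap_apply_of_ne_of_ne hzx hzy]

/-- The shift of the red edges from `x` towards `y`: among two edges `A ∪ {x}` and `A ∪ {y}` of
different colours, the second one becomes red and the first one becomes blue. -/
def shift (x y : V) (c : Finset V → Bool) (e : Finset V) : Bool :=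
  if x ∈ e ∧ y ∉ e then c e && c (swapSet x y e)
  else if y ∈ e ∧ x ∉ e then c e || c (swapSet x y e)
  else c e

lemma shift_insert_left {x y : V} {A : Finset V} (hxy : x ≠ y) (hx : x ∉ A) (hy : y ∉ A) :
    shift x y c (insert x A) = (c (insert x A) && c (insert y A)) := by
  rw [shift, if_pos (by simp [hy, hxy.symm]), swapSet_insert hx hy]

lemma shift_insert_right {x y : V} {A : Finset V} (hxy : x ≠ y) (hx : x ∉ A) (hy : y ∉ A) :
    shift x y c (insert y A) = (c (insert x A) || c (insert y A)) := by
  rw [shift, if_neg (by simp), if_pos (by simp [hx, hxy]), swapSet_comm, swapSet_insert hy hx,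
    Bool.or_comm]

lemma shift_of_mem_iff {x y : V} {e : Finset V} (h : x ∈ e ↔ y ∈ e) : shift x y c e = c e := by
  rw [shift, if_neg (by tauto), if_neg (by tauto)]

/-- Exchanging the colours turns the shift from `x` to `y` into the shift from `y` to `x`. -/
lemma not_shift (x y : V) (e : Finset V) : (!shift x y c e) = shift y x (fun e => !c e) e := by
  unfold shift
  by_cases hx : x ∈ e <;> by_cases hy : y ∈ e <;> simp [hx, hy, swapSet_comm y x]

/-- If `e` and `f` are red after the shift, then `e` was red, or `f` was red up to exchanging `x`
and `y`. -/
lemma of_shift_eq_true [Fintype V] (hk : 3 ≤ k) (hV : Fintype.card V = 4 * k - 3)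
    (h : ∀ b, ¬ MonoQuad k c b) {x y : V} (hxy : x ≠ y) {e f : Finset V} (he : e.card = k)
    (hf : f.card = k) (hef : e = f ∨ Disjoint e f ∨ (e ∩ f).card = 1)
    (ce : shift x y c e = true) (cf : shift x y c f = true) :
    c e = true ∨ c (swapSet x y f) = true := by
  by_contra! hcon
  rw [ne_eq, ne_eq, Bool.not_eq_true, Bool.not_eq_true] at hcon
  obtain ⟨he0, hf0⟩ := hcon
  have hey : y ∈ e ∧ x ∉ e := by
    unfold shift at ce
    split_ifs at ce with h1 h2
    · simp [he0] at ce
    · exact h2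
    · simp [he0] at ce
  have hfy : y ∈ f ∧ x ∉ f := by
    unfold shift at cf
    split_ifs at cf with h1 h2
    · simp [hf0] at cf
    · exact h2
    · rw [swapSet_eq_self (by tauto)] at hf0
      simp [hf0] at cf
  obtain ⟨A, hyA, rfl⟩ : ∃ A, y ∉ A ∧ insert y A = e :=
    ⟨e.erase y, Finset.notMem_erase _ _, Finset.insert_erase hey.1⟩
  obtain ⟨B, hyB, rfl⟩ : ∃ B, y ∉ B ∧ insert y B = f :=
    ⟨f.erase y, Finset.notMem_erase _ _, Finset.insert_erase hfy.1⟩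
  rw [Finset.card_insert_of_notMem hyA] at he
  rw [Finset.card_insert_of_notMem hyB] at hf
  have hxA : x ∉ A := fun h => hey.2 (Finset.mem_insert_of_mem h)
  have hxB : x ∉ B := fun h => hfy.2 (Finset.mem_insert_of_mem h)
  rw [shift_insert_right hxy hxA hyA, he0, Bool.or_false] at ce
  rw [shift_insert_right hxy hxB hyB] at cf
  rw [swapSet_comm, swapSet_insert hyB hxB] at hf0
  rw [hf0, Bool.false_or] at cf
  rcases hef with hef | hef | hef
  · rw [hef, cf] at he0
    cases he0
  · exact Finset.disjoint_left.1 hef hey.1 hfy.1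
  · have hd : Disjoint A B := by
      obtain ⟨z, hz⟩ := Finset.card_eq_one.1 hef
      replace hz := mem_and_mem_iff_of_inter_eq hz
      have h1 := (hz y).1 ⟨hey.1, hfy.1⟩
      refine Finset.disjoint_left.2 fun w hwA hwB => hyA ?_
      have h2 := (hz w).1 ⟨Finset.mem_insert_of_mem hwA, Finset.mem_insert_of_mem hwB⟩
      rwa [h1, ← h2]
    exact not_crossing hk hV h (by omega) (by omega) hd hxA hxB hyA hyB ce he0 hf0 cf

lemma not_monoQuad_true_shift [Fintype V] (hk : 3 ≤ k) (hV : Fintype.card V = 4 * k - 3)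
    (h : ∀ b, ¬ MonoQuad k c b) {x y : V} (hxy : x ≠ y) : ¬ MonoQuad k (shift x y c) true := by
  rintro ⟨e₁, e₂, e₃, e₄, hq, c₁, c₂, c₃, c₄⟩
  have hq' := hq
  obtain ⟨h₁, h₂, h₃, h₄, h₁₂, h₂₃, h₃₄, h₄₁, d₁₃, d₂₄⟩ := hq
  have key : ∀ e ∈ [e₁, e₂, e₃, e₄], ∀ f ∈ [e₁, e₂, e₃, e₄],
      c e = true ∨ c (swapSet x y f) = true := by
    have h₂₁ := h₁₂
    have h₃₂ := h₂₃
    have h₄₃ := h₃₄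
    have h₁₄ := h₄₁
    rw [Finset.inter_comm] at h₂₁ h₃₂ h₄₃ h₁₄
    have d₃₁ := d₁₃.symm
    have d₄₂ := d₂₄.symm
    have gen : ∀ e f : Finset V, e.card = k → f.card = k →
        (e = f ∨ Disjoint e f ∨ (e ∩ f).card = 1) → shift x y c e = true →
        shift x y c f = true → c e = true ∨ c (swapSet x y f) = true :=
      fun e f he hf hef ce cf => of_shift_eq_true hk hV h hxy he hf hef ce cf
    simp only [List.forall_mem_cons, List.not_mem_nil, false_imp_iff, implies_true, and_true]
    refine ⟨⟨?_, ?_, ?_, ?_⟩, ⟨?_, ?_, ?_, ?_⟩, ⟨?_, ?_, ?_, ?_⟩, ⟨?_, ?_, ?_, ?_⟩⟩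
    all_goals
      refine gen _ _ ?_ ?_ ?_ ?_ ?_
      · assumption
      · assumption
      · first
        | exact .inl rfl
        | (refine .inr (.inl ?_); assumption)
        | (refine .inr (.inr ?_); assumption)
      · assumption
      · assumption
  by_cases hall : ∀ e ∈ [e₁, e₂, e₃, e₄], c e = true
  · exact h true ⟨e₁, e₂, e₃, e₄, hq', hall _ (by simp), hall _ (by simp), hall _ (by simp),
      hall _ (by simp)⟩
  · push Not at hall
    obtain ⟨e, he, hce⟩ := hall
    have hall' := fun f hf => (key e he f hf).resolve_left hce
    exact h true ⟨_, _, _, _, hq'.map (Equiv.swap x y).toEmbedding, hall' _ (by simp),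
      hall' _ (by simp), hall' _ (by simp), hall' _ (by simp)⟩

/-- Shifting does not create monochromatic loose four-cycles. -/
lemma not_monoQuad_shift [Fintype V] (hk : 3 ≤ k) (hV : Fintype.card V = 4 * k - 3)
    (h : ∀ b, ¬ MonoQuad k c b) {x y : V} (hxy : x ≠ y) (b : Bool) :
    ¬ MonoQuad k (shift x y c) b := by
  have hneg : ∀ {c : Finset V → Bool} {b : Bool}, MonoQuad k c b →
      MonoQuad k (fun e => !c e) (!b) := by
    rintro c b ⟨e₁, e₂, e₃, e₄, hq, c₁, c₂, c₃, c₄⟩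
    exact ⟨e₁, e₂, e₃, e₄, hq, congrArg _ c₁, congrArg _ c₂, congrArg _ c₃, congrArg _ c₄⟩
  cases b with
  | true => exact not_monoQuad_true_shift hk hV h hxy
  | false =>
    intro hm
    have h1 := hneg hm
    simp only [not_shift] at h1
    refine not_monoQuad_true_shift hk hV (fun b hb => h (!b) ?_) hxy.symm h1
    simpa using hneg hb

end Shift

section Shifted

variable {N k : ℕ}

/-- A colouring of the sets of vertices `0, …, N - 1` is shifted if red edges stay red when a vertex
is replaced by a larger one. -/
def IsShifted (c : Finset (Fin N) → Bool) : Prop :=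
  ∀ x y : Fin N, x < y → ∀ A : Finset (Fin N), x ∉ A → y ∉ A →
    c (insert x A) = true → c (insert y A) = true

/-- The sum of the vertices of all red edges, which increases under nontrivial shifts. -/
def redWeight (c : Finset (Fin N) → Bool) : ℤ :=
  ∑ e, if c e = true then ∑ i ∈ e, ((i : ℕ) : ℤ) else 0

lemma redWeight_lt_shift {c : Finset (Fin N) → Bool} {x y : Fin N} (hxy : x < y)
    {A : Finset (Fin N)} (hx : x ∉ A) (hy : y ∉ A) (c₁ : c (insert x A) = true)
    (c₂ : c (insert y A) = false) : redWeight c < redWeight (shift x y c) := by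
  let w : Finset (Fin N) → ℤ := fun e => ∑ i ∈ e, ((i : ℕ) : ℤ)
  let d : Finset (Fin N) → ℤ := fun e =>
    (if shift x y c e = true then w e else 0) - if c e = true then w e else 0
  have hw : w (insert y A) - w (insert x A) = (y : ℕ) - (x : ℕ) := by
    simp only [w, Finset.sum_insert hx, Finset.sum_insert hy]
    ring
  have hpos : 0 < w (insert y A) - w (insert x A) := by rw [hw]; simpa using hxy
  have hsum : redWeight (shift x y c) - redWeight c = ∑ e, d e := by
    simp only [redWeight, d, w, Finset.sum_sub_distrib]
  have hswap : ∑ e, d (swapSet x y e) = ∑ e, d e :=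
    Equiv.sum_comp (Function.Involutive.toPerm _ (swapSet_swapSet x y)) d
  -- an edge and its image under the transposition together gain weight
  have hpair : ∀ B : Finset (Fin N), x ∉ B → y ∉ B →
      0 ≤ d (insert x B) + d (insert y B) := by
    intro B hxB hyB
    have : w (insert x B) ≤ w (insert y B) := by
      simp only [w, Finset.sum_insert hxB, Finset.sum_insert hyB]
      have : (x : ℕ) < (y : ℕ) := hxy
      omega
    simp only [d, shift_insert_left hxy.ne hxB hyB, shift_insert_right hxy.ne hxB hyB]
    cases c (insert x B) <;> cases c (insert y B) <;> simp [this]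
  have hnonneg : ∀ e, 0 ≤ d e + d (swapSet x y e) := by
    intro e
    by_cases h : x ∈ e ↔ y ∈ e
    · simp only [d, swapSet_eq_self h, shift_of_mem_iff h, sub_self, add_zero, le_refl]
    · by_cases hxe : x ∈ e
      · have hye : y ∉ e := by tauto
        obtain ⟨B, hB, rfl⟩ : ∃ B, x ∉ B ∧ insert x B = e :=
          ⟨e.erase x, Finset.notMem_erase _ _, Finset.insert_erase hxe⟩
        have hyB : y ∉ B := fun h => hye (Finset.mem_insert_of_mem h)
        rw [swapSet_insert hB hyB]
        exact hpair B hB hyB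
      · have hye : y ∈ e := by tauto
        obtain ⟨B, hB, rfl⟩ : ∃ B, y ∉ B ∧ insert y B = e :=
          ⟨e.erase y, Finset.notMem_erase _ _, Finset.insert_erase hye⟩
        have hxB : x ∉ B := fun h => hxe (Finset.mem_insert_of_mem h)
        rw [swapSet_comm, swapSet_insert hB hxB, add_comm]
        exact hpair B hxB hB
  have hlt : 0 < ∑ e, (d e + d (swapSet x y e)) := by
    refine Finset.sum_pos' (fun e _ => hnonneg e) ⟨insert x A, Finset.mem_univ _, ?_⟩
    rw [swapSet_insert hx hy]
    simp only [d, shift_insert_left hxy.ne hx hy, shift_insert_right hxy.ne hx hy, c₁, c₂]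
    simp only [Bool.and_false, Bool.or_false, Bool.false_eq_true, if_false, if_true]
    omega
  rw [Finset.sum_add_distrib, hswap] at hlt
  omega

/-- In a shifted colouring, an edge is red if it dominates a red edge position by position. -/
lemma IsShifted.image_eq_true {c : Finset (Fin N) → Bool} (h : IsShifted c) {f g : Fin k → Fin N}
    (hf : StrictMono f) (hg : StrictMono g) (hfg : ∀ t, f t ≤ g t)
    (hc : c (Finset.univ.image f) = true) : c (Finset.univ.image g) = true := by
  -- the positions are raised one by one, from the last to the first
  let F : ℕ → Fin k → Fin N := fun s t => if (t : ℕ) < s then f t else g t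
  have hF : ∀ s, Function.Injective (F s) := by
    intro s
    refine StrictMono.injective fun t u htu => ?_
    simp only [F]
    have htu' : (t : ℕ) < u := htu
    split_ifs with h1 h2
    · exact hf htu
    · exact (hfg t).trans_lt (hg htu)
    · omega
    · exact hg htu
  have hF0 : F 0 = g := by funext t; simp [F]
  have hFk : F k = f := by funext t; simp [F]
  suffices ∀ j ≤ k, c (Finset.univ.image (F (k - j))) = true by
    simpa [hF0] using this k le_rfl
  intro j
  induction j with
  | zero => intro _; simpa [hFk] using hc
  | succ j ih =>
    intro hj
    have hs := ih (by omega)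
    obtain ⟨s, hs1, hs2⟩ : ∃ s, k - j = s + 1 ∧ k - (j + 1) = s := ⟨k - (j + 1), by omega, rfl⟩
    rw [hs1] at hs
    rw [hs2]
    let t : Fin k := ⟨s, by omega⟩
    let A := (Finset.univ.erase t).image (F s)
    have hsucc : ∀ u, u ≠ t → F (s + 1) u = F s u := by
      intro u hu
      have : (u : ℕ) ≠ s := fun h => hu (Fin.ext h)
      simp only [F]
      split_ifs <;> first | rfl | omega
    have hA : A = (Finset.univ.erase t).image (F (s + 1)) :=
      Finset.image_congr fun u hu => (hsucc u (by simpa using hu)).symm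
    have himg : ∀ s', Finset.univ.image (F s') =
        insert (F s' t) ((Finset.univ.erase t).image (F s')) := by
      intro s'
      rw [← Finset.image_insert, Finset.insert_erase (Finset.mem_univ t)]
    have hnot : ∀ s', F s' t ∉ (Finset.univ.erase t).image (F s') := by
      intro s' hmem
      obtain ⟨u, hu, hut⟩ := Finset.mem_image.1 hmem
      exact Finset.ne_of_mem_erase hu (hF s' hut)
    rw [himg, ← hA] at hs
    rw [himg]
    have hft : F (s + 1) t = f t := if_pos (Nat.lt_succ_self s)
    have hgt : F s t = g t := if_neg (lt_irrefl s)
    rcases (hfg t).eq_or_lt with heq | hlt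
    · rwa [hgt, ← heq, ← hft]
    · refine h (F (s + 1) t) (F s t) (by rwa [hft, hgt]) A ?_ (hnot s) hs
      rw [hA]
      exact hnot (s + 1)

/-- The `t`-th smallest vertex of the `i`-th edge in a loose four-cycle whose vertices are as small
as possible: the connecting vertices are `0, …, 3`, and the other vertices are distributed
cyclically. -/
def lowVertex (i t : ℕ) : ℕ :=
  if t = 0 then (if i = 1 ∨ i = 2 then 1 else 0)
  else if t = 1 then (if i < 2 then 2 else 3)
  else 4 * (t - 1) + i

lemma lowVertex_add_le {i j t s : ℕ} (hk : 3 ≤ k) (hi : i < 4) (hj : j < 4) (hts : t + s + 1 = k) :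
    lowVertex i t + lowVertex j s ≤ 4 * k - 4 := by
  unfold lowVertex
  split_ifs <;> omega

lemma lowVertex_lt {i t : ℕ} (hk : 3 ≤ k) (hi : i < 4) (ht : t < k) :
    lowVertex i t < 4 * k - 3 := by
  unfold lowVertex
  split_ifs <;> omega

lemma lowVertex_strictMono {i : ℕ} (hi : i < 4) : StrictMono (lowVertex i) := by
  refine strictMono_nat_of_lt_succ fun t => ?_
  unfold lowVertex
  split_ifs <;> first | contradiction | omega

/-- A shifted colouring has a monochromatic loose four-cycle: if some edge of the lowest one is
red, then all edges of its reversal are red. -/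
lemma IsShifted.exists_monoQuad {c : Finset (Fin (4 * k - 3)) → Bool} (hk : 3 ≤ k)
    (h : IsShifted c) : ∃ b, MonoQuad k c b := by
  let u : ℕ → Fin k → Fin (4 * k - 3) := fun i t =>
    if hi : i < 4 then ⟨lowVertex i t, lowVertex_lt hk hi t.2⟩ else ⟨0, by omega⟩
  have hu : ∀ i < 4, ∀ t, (u i t : ℕ) = lowVertex i t := fun i hi t => by simp [u, hi]
  have hmono : ∀ i < 4, StrictMono (u i) := by
    intro i hi s t hst
    rw [Fin.lt_def, hu i hi, hu i hi]
    exact lowVertex_strictMono hi hst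
  let L : ℕ → Finset (Fin (4 * k - 3)) := fun i => Finset.univ.image (u i)
  have hcard : ∀ i < 4, (L i).card = k := fun i hi => by
    rw [Finset.card_image_of_injective _ (hmono i hi).injective]; simp
  have hmem : ∀ i < 4, ∀ z, z ∈ L i ↔ ∃ t < k, lowVertex i t = z := by
    intro i hi z
    simp only [L, Finset.mem_image, Finset.mem_univ, true_and]
    constructor
    · rintro ⟨t, rfl⟩
      exact ⟨t, t.2, (hu i hi t).symm⟩
    · rintro ⟨t, ht, hz⟩
      exact ⟨⟨t, ht⟩, Fin.ext ((hu i hi _).trans hz)⟩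
  have hinter : ∀ i < 4, ∀ j < 4, ∀ p < 4, lowVertex i (p / 2) = p → lowVertex j (p / 2) = p →
      (∀ s t, lowVertex i s = lowVertex j t → lowVertex i s = p) → (L i ∩ L j).card = 1 := by
    intro i hi j hj p hp h1 h2 h3
    refine Finset.card_eq_one.2 ⟨⟨p, by omega⟩, ?_⟩
    ext z
    rw [Finset.mem_inter, hmem i hi, hmem j hj, Finset.mem_singleton, Fin.ext_iff]
    constructor
    · rintro ⟨⟨s, -, hs⟩, ⟨t, -, ht⟩⟩
      rw [← hs]
      exact h3 s t (hs.trans ht.symm)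
    · intro hz
      exact ⟨⟨p / 2, by omega, h1.trans hz.symm⟩, ⟨p / 2, by omega, h2.trans hz.symm⟩⟩
  have hdisj : ∀ i < 4, ∀ j < 4, (∀ s t, lowVertex i s ≠ lowVertex j t) →
      Disjoint (L i) (L j) := by
    intro i hi j hj h1
    refine Finset.disjoint_left.2 fun z hz hz' => ?_
    obtain ⟨s, -, hs⟩ := (hmem i hi z).1 hz
    obtain ⟨t, -, ht⟩ := (hmem j hj z).1 hz'
    exact h1 s t (hs.trans ht.symm)
  have hL : IsQuad k (L 0) (L 1) (L 2) (L 3) := by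
    refine ⟨hcard 0 (by omega), hcard 1 (by omega), hcard 2 (by omega), hcard 3 (by omega),
      hinter 0 (by omega) 1 (by omega) 2 (by omega) rfl rfl ?_,
      hinter 1 (by omega) 2 (by omega) 1 (by omega) rfl rfl ?_,
      hinter 2 (by omega) 3 (by omega) 3 (by omega) rfl rfl ?_,
      hinter 3 (by omega) 0 (by omega) 0 (by omega) rfl rfl ?_,
      hdisj 0 (by omega) 2 (by omega) ?_, hdisj 1 (by omega) 3 (by omega) ?_⟩
    all_goals
      intro s t h
      simp only [lowVertex] at h ⊢
      split_ifs at h ⊢ <;> first | contradiction | omega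
  by_cases hblue : ∀ i < 4, c (L i) = false
  · exact ⟨false, _, _, _, _, hL, hblue 0 (by omega), hblue 1 (by omega), hblue 2 (by omega),
      hblue 3 (by omega)⟩
  push Not at hblue
  obtain ⟨i, hi, hred⟩ := hblue
  rw [ne_eq, Bool.not_eq_false] at hred
  refine ⟨true, ?_⟩
  have hrev : ∀ j < 4, c ((L j).map Fin.revPerm.toEmbedding) = true := by
    intro j hj
    have : (L j).map Fin.revPerm.toEmbedding =
        Finset.univ.image (fun t : Fin k => (u j t.rev).rev) := by
      ext z
      simp only [L, Finset.mem_map_equiv, Finset.mem_image, Finset.mem_univ, true_and,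
        Fin.revPerm_symm, Fin.revPerm_apply]
      constructor
      · rintro ⟨t, ht⟩
        exact ⟨t.rev, by rw [Fin.rev_rev, ht, Fin.rev_rev]⟩
      · rintro ⟨t, rfl⟩
        exact ⟨t.rev, by rw [Fin.rev_rev]⟩
    rw [this]
    refine h.image_eq_true (hmono i hi) ?_ ?_ hred
    · intro s t hst
      exact Fin.rev_lt_rev.2 (hmono j hj (Fin.rev_lt_rev.2 hst))
    · intro t
      rw [Fin.le_def, Fin.val_rev, hu i hi, hu j hj, Fin.val_rev]
      have := lowVertex_add_le (t := t) (s := k - (t + 1)) hk hi hj (by omega)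
      omega
  exact ⟨_, _, _, _, hL.map _, hrev 0 (by omega), hrev 1 (by omega), hrev 2 (by omega),
    hrev 3 (by omega)⟩

theorem exists_monoQuad {V : Type*} [DecidableEq V] [Fintype V] (hk : 3 ≤ k)
    (hV : Fintype.card V = 4 * k - 3) (c : Finset V → Bool) : ∃ b, MonoQuad k c b := by
  by_contra! hcon
  let ι := (Fintype.equivFinOfCardEq hV).symm.toEmbedding
  have hne : ({c | ∀ b, ¬ MonoQuad k c b} : Set (Finset (Fin (4 * k - 3)) → Bool)).Nonempty :=
    ⟨fun e => c (e.map ι), fun b hb => hcon b (hb.map ι)⟩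
  -- a counterexample with the largest weight is shifted
  obtain ⟨c', hc', hmax⟩ := Set.exists_max_image _ redWeight (Set.toFinite _) hne
  have hsh : IsShifted c' := by
    intro x y hxy A hx hy h1
    by_contra h2
    rw [Bool.not_eq_true] at h2
    have h3 := hmax (shift x y c')
      (fun b => not_monoQuad_shift hk (Fintype.card_fin _) hc' hxy.ne b)
    exact absurd (redWeight_lt_shift hxy hx hy h1 h2) (not_lt.2 h3)
  obtain ⟨b, hb⟩ := hsh.exists_monoQuad hk
  exact hc' b hb

end Shifted

/-! ### Four-cycles against triangles -/

section Unequal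

variable {V : Type*} [DecidableEq V] {k : ℕ} {c : Finset V → Bool} {b : Bool}

lemma IsQuad.isPath3 {e₁ e₂ e₃ e₄ : Finset V} (h : IsQuad k e₁ e₂ e₃ e₄) : IsPath3 k e₁ e₂ e₃ :=
  ⟨h.card₁, h.card₂, h.card₃, h.inter₁₂, h.inter₂₃, h.disj₁₃⟩

lemma IsQuad.rotate {e₁ e₂ e₃ e₄ : Finset V} (h : IsQuad k e₁ e₂ e₃ e₄) : IsQuad k e₂ e₃ e₄ e₁ :=
  ⟨h.card₂, h.card₃, h.card₄, h.card₁, h.inter₂₃, h.inter₃₄, h.inter₄₁, h.inter₁₂, h.disj₂₄,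
    h.disj₁₃.symm⟩

lemma IsPath3.reverse {e₁ e₂ e₃ : Finset V} (h : IsPath3 k e₁ e₂ e₃) : IsPath3 k e₃ e₂ e₁ :=
  ⟨h.card₃, h.card₂, h.card₁, by rw [Finset.inter_comm, h.inter₂₃],
    by rw [Finset.inter_comm, h.inter₁₂], h.disj₁₃.symm⟩

/-- The edges of a loose triangle, written in terms of the three connecting vertices and the
remaining vertices of each edge. -/
lemma IsTri.exists_parts {e₁ e₂ e₃ : Finset V} (h : IsTri k e₁ e₂ e₃) :
    ∃ (v₁ v₂ v₃ : V) (X₁ X₂ X₃ : Finset V), e₁ = insert v₁ (insert v₂ X₁) ∧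
      e₂ = insert v₂ (insert v₃ X₂) ∧ e₃ = insert v₃ (insert v₁ X₃) ∧
      X₁.card = k - 2 ∧ X₂.card = k - 2 ∧ X₃.card = k - 2 ∧
      (∀ z ∈ X₁, z ∉ X₂ ∧ z ∉ X₃ ∧ z ≠ v₁ ∧ z ≠ v₂ ∧ z ≠ v₃) ∧
      (∀ z ∈ X₂, z ∉ X₁ ∧ z ∉ X₃ ∧ z ≠ v₁ ∧ z ≠ v₂ ∧ z ≠ v₃) ∧
      (∀ z ∈ X₃, z ∉ X₁ ∧ z ∉ X₂ ∧ z ≠ v₁ ∧ z ≠ v₂ ∧ z ≠ v₃) ∧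
      v₁ ≠ v₂ ∧ v₁ ≠ v₃ ∧ v₂ ≠ v₃ := by
  obtain ⟨h₁, h₂, h₃, h₁₂, h₂₃, h₃₁, hd⟩ := h
  obtain ⟨p, hp⟩ := Finset.card_eq_one.1 h₁₂
  obtain ⟨q, hq⟩ := Finset.card_eq_one.1 h₂₃
  obtain ⟨r, hr⟩ := Finset.card_eq_one.1 h₃₁
  replace hp := mem_and_mem_iff_of_inter_eq hp
  replace hq := mem_and_mem_iff_of_inter_eq hq
  replace hr := mem_and_mem_iff_of_inter_eq hr
  rw [Finset.disjoint_left] at hd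
  have hp' := (hp p).2 rfl
  have hq' := (hq q).2 rfl
  have hr' := (hr r).2 rfl
  clear h₁₂ h₂₃ h₃₁
  have hpq : p ≠ q := by grind
  have hqr : q ≠ r := by grind
  have hrp : r ≠ p := by grind
  refine ⟨r, p, q, (e₁.erase r).erase p, (e₂.erase p).erase q, (e₃.erase q).erase r,
    ?_, ?_, ?_, ?_, ?_, ?_, ?_, ?_, ?_, hrp, hqr.symm, hpq⟩
  · ext z; grind
  · ext z; grind
  · ext z; grind
  · rw [Finset.card_erase_of_mem (by grind), Finset.card_erase_of_mem (by grind), h₁]; rfl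
  · rw [Finset.card_erase_of_mem (by grind), Finset.card_erase_of_mem (by grind), h₂]; rfl
  · rw [Finset.card_erase_of_mem (by grind), Finset.card_erase_of_mem (by grind), h₃]; rfl
  · grind
  · grind
  · grind

/-- The edges of a loose four-cycle, written in terms of the four connecting vertices and the
remaining vertices of each edge. -/
lemma IsQuad.exists_parts {e₁ e₂ e₃ e₄ : Finset V} (h : IsQuad k e₁ e₂ e₃ e₄) :
    ∃ (v₁ v₂ v₃ v₄ : V) (X₁ X₂ X₃ X₄ : Finset V), e₁ = insert v₁ (insert v₂ X₁) ∧
      e₂ = insert v₂ (insert v₃ X₂) ∧ e₃ = insert v₃ (insert v₄ X₃) ∧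
      e₄ = insert v₄ (insert v₁ X₄) ∧
      X₁.card = k - 2 ∧ X₂.card = k - 2 ∧ X₃.card = k - 2 ∧ X₄.card = k - 2 ∧
      (∀ z ∈ X₁, z ∉ X₂ ∧ z ∉ X₃ ∧ z ∉ X₄ ∧ z ≠ v₁ ∧ z ≠ v₂ ∧ z ≠ v₃ ∧ z ≠ v₄) ∧
      (∀ z ∈ X₂, z ∉ X₁ ∧ z ∉ X₃ ∧ z ∉ X₄ ∧ z ≠ v₁ ∧ z ≠ v₂ ∧ z ≠ v₃ ∧ z ≠ v₄) ∧
      (∀ z ∈ X₃, z ∉ X₁ ∧ z ∉ X₂ ∧ z ∉ X₄ ∧ z ≠ v₁ ∧ z ≠ v₂ ∧ z ≠ v₃ ∧ z ≠ v₄) ∧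
      (∀ z ∈ X₄, z ∉ X₁ ∧ z ∉ X₂ ∧ z ∉ X₃ ∧ z ≠ v₁ ∧ z ≠ v₂ ∧ z ≠ v₃ ∧ z ≠ v₄) ∧
      v₁ ≠ v₂ ∧ v₁ ≠ v₃ ∧ v₁ ≠ v₄ ∧ v₂ ≠ v₃ ∧ v₂ ≠ v₄ ∧ v₃ ≠ v₄ := by
  obtain ⟨h₁, h₂, h₃, h₄, h₁₂, h₂₃, h₃₄, h₄₁, hd, hd'⟩ := h
  obtain ⟨p, hp⟩ := Finset.card_eq_one.1 h₁₂
  obtain ⟨q, hq⟩ := Finset.card_eq_one.1 h₂₃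
  obtain ⟨r, hr⟩ := Finset.card_eq_one.1 h₃₄
  obtain ⟨s, hs⟩ := Finset.card_eq_one.1 h₄₁
  replace hp := mem_and_mem_iff_of_inter_eq hp
  replace hq := mem_and_mem_iff_of_inter_eq hq
  replace hr := mem_and_mem_iff_of_inter_eq hr
  replace hs := mem_and_mem_iff_of_inter_eq hs
  rw [Finset.disjoint_left] at hd hd'
  have hp' := (hp p).2 rfl
  have hq' := (hq q).2 rfl
  have hr' := (hr r).2 rfl
  have hs' := (hs s).2 rfl
  clear h₁₂ h₂₃ h₃₄ h₄₁
  refine ⟨s, p, q, r, (e₁.erase s).erase p, (e₂.erase p).erase q, (e₃.erase q).erase r,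
    (e₄.erase r).erase s, ?_, ?_, ?_, ?_, ?_, ?_, ?_, ?_, ?_, ?_, ?_, ?_, by grind, by grind,
    by grind, by grind, by grind, by grind⟩
  · ext z; grind
  · ext z; grind
  · ext z; grind
  · ext z; grind
  · rw [Finset.card_erase_of_mem (by grind), Finset.card_erase_of_mem (by grind), h₁]; rfl
  · rw [Finset.card_erase_of_mem (by grind), Finset.card_erase_of_mem (by grind), h₂]; rfl
  · rw [Finset.card_erase_of_mem (by grind), Finset.card_erase_of_mem (by grind), h₃]; rfl
  · rw [Finset.card_erase_of_mem (by grind), Finset.card_erase_of_mem (by grind), h₄]; rfl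
  · grind
  · grind
  · grind
  · grind

lemma card_union_parts₃ {v₁ v₂ v₃ : V} {X₁ X₂ X₃ : Finset V} (hk : 2 ≤ k)
    (h₁ : X₁.card = k - 2) (h₂ : X₂.card = k - 2) (h₃ : X₃.card = k - 2) :
    (insert v₁ (insert v₂ (insert v₃ (X₁ ∪ X₂ ∪ X₃)))).card ≤ 3 * k - 3 := by
  have := Finset.card_insert_le v₁ (insert v₂ (insert v₃ (X₁ ∪ X₂ ∪ X₃)))
  have := Finset.card_insert_le v₂ (insert v₃ (X₁ ∪ X₂ ∪ X₃))
  have := Finset.card_insert_le v₃ (X₁ ∪ X₂ ∪ X₃)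
  have := Finset.card_union_le (X₁ ∪ X₂) X₃
  have := Finset.card_union_le X₁ X₂
  omega

lemma card_union_parts₄ {v₁ v₂ v₃ v₄ : V} {X₁ X₂ X₃ X₄ : Finset V} (hk : 2 ≤ k)
    (h₁ : X₁.card = k - 2) (h₂ : X₂.card = k - 2) (h₃ : X₃.card = k - 2) (h₄ : X₄.card = k - 2) :
    (insert v₁ (insert v₂ (insert v₃ (insert v₄ (X₁ ∪ X₂ ∪ X₃ ∪ X₄))))).card ≤ 4 * k - 4 := by
  have := Finset.card_insert_le v₁ (insert v₂ (insert v₃ (insert v₄ (X₁ ∪ X₂ ∪ X₃ ∪ X₄))))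
  have := Finset.card_insert_le v₂ (insert v₃ (insert v₄ (X₁ ∪ X₂ ∪ X₃ ∪ X₄)))
  have := Finset.card_insert_le v₃ (insert v₄ (X₁ ∪ X₂ ∪ X₃ ∪ X₄))
  have := Finset.card_insert_le v₄ (X₁ ∪ X₂ ∪ X₃ ∪ X₄)
  have := Finset.card_union_le (X₁ ∪ X₂ ∪ X₃) X₄
  have := Finset.card_union_le (X₁ ∪ X₂) X₃
  have := Finset.card_union_le X₁ X₂
  omega

/-- Closing two consecutive edges of colour `b` to a triangle needs an edge of the same colour. -/
lemma eq_not_of_not_monoTri (hk : 2 ≤ k) (h : ¬ MonoTri k c b) {e f T : Finset V} {q r : V}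
    (he : e.card = k) (hf : f.card = k) (hef : (e ∩ f).card = 1) (ce : c e = b) (cf : c f = b)
    (hq : q ∈ e) (hqf : q ∉ f) (hr : r ∈ f) (hre : r ∉ e) (hT : T.card = k - 2)
    (hTe : ∀ z ∈ T, z ∉ e ∧ z ∉ f) : c (insert q (insert r T)) = !b := by
  by_contra hcon
  replace hcon : c (insert q (insert r T)) = b := by simpa using hcon
  have hg : (insert q (insert r T)).card = k := by
    rw [Finset.card_insert_of_notMem (by grind), Finset.card_insert_of_notMem (by grind)]; omega
  refine h ⟨e, f, _, ⟨he, hf, hg, hef, ?_, ?_, ?_⟩, ce, cf, hcon⟩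
  all_goals clear he hf hef ce cf hT hg hcon h
  · exact Finset.card_eq_one.2 ⟨r, by ext w; grind⟩
  · exact Finset.card_eq_one.2 ⟨q, by ext w; grind⟩
  · rw [Finset.disjoint_left]; grind

/-- Extending a path of colour `b` with two edges needs an edge of the same colour. -/
lemma eq_not_of_not_monoPath3 (hk : 2 ≤ k) (h : ¬ MonoPath3 k c b) {e f T : Finset V} {z : V}
    (he : e.card = k) (hf : f.card = k) (hef : (e ∩ f).card = 1) (ce : c e = b) (cf : c f = b)
    (hz : z ∈ f) (hze : z ∉ e) (hT : T.card = k - 1) (hTe : ∀ z ∈ T, z ∉ e ∧ z ∉ f) :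
    c (insert z T) = !b := by
  by_contra hcon
  replace hcon : c (insert z T) = b := by simpa using hcon
  have hg : (insert z T).card = k := by
    rw [Finset.card_insert_of_notMem (by grind)]; omega
  refine h ⟨e, f, _, ⟨he, hf, hg, hef, ?_, ?_⟩, ce, cf, hcon⟩
  all_goals clear he hf hef ce cf hT hg hcon h
  · exact Finset.card_eq_one.2 ⟨z, by ext w; grind⟩
  · rw [Finset.disjoint_left]; grind

/-- Extending a path of colour `b` with three edges needs an edge of the same colour. -/
lemma eq_not_of_not_monoPath4 (hk : 2 ≤ k) (h : ¬ MonoPath4 k c b) {e₁ e₂ e₃ T : Finset V} {z : V}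
    (he : IsPath3 k e₁ e₂ e₃) (c₁ : c e₁ = b) (c₂ : c e₂ = b) (c₃ : c e₃ = b)
    (hz : z ∈ e₃) (hze : z ∉ e₂) (hT : T.card = k - 1)
    (hTe : ∀ z ∈ T, z ∉ e₁ ∧ z ∉ e₂ ∧ z ∉ e₃) : c (insert z T) = !b := by
  by_contra hcon
  replace hcon : c (insert z T) = b := by simpa using hcon
  have hg : (insert z T).card = k := by
    rw [Finset.card_insert_of_notMem (by grind)]; omega
  obtain ⟨h₁, h₂, h₃, h₁₂, h₂₃, hd⟩ := he
  refine h ⟨e₁, e₂, e₃, _, ⟨h₁, h₂, h₃, hg, h₁₂, h₂₃, ?_, hd, ?_, ?_⟩, c₁, c₂, c₃, hcon⟩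
  all_goals
    rw [Finset.disjoint_left] at hd
    clear h₁ h₂ h₃ h₁₂ h₂₃ c₁ c₂ c₃ hT hg hcon h
  · exact Finset.card_eq_one.2 ⟨z, by ext w; grind⟩
  · rw [Finset.disjoint_left]; grind
  · rw [Finset.disjoint_left]; grind

/-- If the edges of colour `b` contain a loose four-cycle but no loose triangle, then there is a
loose four-cycle of the other colour. -/
lemma MonoQuad.not_of_not_monoTri [Fintype V] (hk : 3 ≤ k) (hV : Fintype.card V = 4 * k - 3)
    (hm : MonoQuad k c b) (h : ¬ MonoTri k c b) : MonoQuad k c (!b) := by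
  obtain ⟨e₁, e₂, e₃, e₄, hq, c₁, c₂, c₃, c₄⟩ := hm
  obtain ⟨v₁, v₂, v₃, v₄, X₁, X₂, X₃, X₄, E₁, E₂, E₃, E₄, n₁, n₂, n₃, n₄, d₁, d₂, d₃, d₄,
    h₁₂, h₁₃, h₁₄, h₂₃, h₂₄, h₃₄⟩ := hq.exists_parts
  obtain ⟨u, hu⟩ : ∃ u, u ∉ insert v₁ (insert v₂ (insert v₃ (insert v₄ (X₁ ∪ X₂ ∪ X₃ ∪ X₄)))) := by
    by_contra! hall
    have := card_union_parts₄ (v₁ := v₁) (v₂ := v₂) (v₃ := v₃) (v₄ := v₄) (by omega) n₁ n₂ n₃ n₄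
    rw [(Finset.eq_univ_iff_forall).2 hall, Finset.card_univ] at this
    omega
  simp only [Finset.mem_insert, Finset.mem_union, not_or] at hu
  obtain ⟨x₁, hx₁⟩ : X₁.Nonempty := Finset.card_pos.1 (by omega)
  obtain ⟨x₂, hx₂⟩ : X₂.Nonempty := Finset.card_pos.1 (by omega)
  obtain ⟨x₃, hx₃⟩ : X₃.Nonempty := Finset.card_pos.1 (by omega)
  obtain ⟨x₄, hx₄⟩ : X₄.Nonempty := Finset.card_pos.1 (by omega)
  have m₁ : (X₁.erase x₁).card = k - 3 := by rw [Finset.card_erase_of_mem hx₁, n₁]; rfl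
  have m₂ : (X₂.erase x₂).card = k - 3 := by rw [Finset.card_erase_of_mem hx₂, n₂]; rfl
  have m₃ : (X₃.erase x₃).card = k - 3 := by rw [Finset.card_erase_of_mem hx₃, n₃]; rfl
  have m₄ : (X₄.erase x₄).card = k - 3 := by rw [Finset.card_erase_of_mem hx₄, n₄]; rfl
  have t₁ : (insert u (X₄.erase x₄)).card = k - 2 := by
    rw [Finset.card_insert_of_notMem (by simp [hu]), m₄]; omega
  have t₂ : (insert u (X₁.erase x₁)).card = k - 2 := by
    rw [Finset.card_insert_of_notMem (by simp [hu]), m₁]; omega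
  have t₃ : (insert x₁ (X₂.erase x₂)).card = k - 2 := by
    rw [Finset.card_insert_of_notMem (by simp [d₁ _ hx₁]), m₂]; omega
  have t₄ : (insert x₂ (X₃.erase x₃)).card = k - 2 := by
    rw [Finset.card_insert_of_notMem (by simp [d₂ _ hx₂]), m₃]; omega
  have f₁ : c (insert v₁ (insert x₂ (insert u (X₄.erase x₄)))) = !b := by
    refine eq_not_of_not_monoTri (by omega) h hq.card₁ hq.card₂ hq.inter₁₂ c₁ c₂ ?_ ?_ ?_ ?_ t₁ ?_
    all_goals
      clear * - E₁ E₂ d₁ d₂ d₄ h₁₂ h₁₃ h₁₄ h₂₃ h₂₄ h₃₄ hx₂ hx₄ hu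
      grind
  have f₂ : c (insert v₂ (insert x₃ (insert u (X₁.erase x₁)))) = !b := by
    refine eq_not_of_not_monoTri (by omega) h hq.card₂ hq.card₃ hq.inter₂₃ c₂ c₃ ?_ ?_ ?_ ?_ t₂ ?_
    all_goals
      clear * - E₂ E₃ d₁ d₂ d₃ h₁₂ h₁₃ h₁₄ h₂₃ h₂₄ h₃₄ hx₃ hx₁ hu
      grind
  have f₃ : c (insert x₃ (insert x₄ (insert x₁ (X₂.erase x₂)))) = !b := by
    refine eq_not_of_not_monoTri (by omega) h hq.card₃ hq.card₄ hq.inter₃₄ c₃ c₄ ?_ ?_ ?_ ?_ t₃ ?_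
    all_goals
      clear * - E₃ E₄ d₁ d₂ d₃ d₄ h₁₂ h₁₃ h₁₄ h₂₃ h₂₄ h₃₄ hx₁ hx₂ hx₃ hx₄
      grind
  have f₄ : c (insert v₄ (insert x₁ (insert x₂ (X₃.erase x₃)))) = !b := by
    refine eq_not_of_not_monoTri (by omega) h hq.card₄ hq.card₁ hq.inter₄₁ c₄ c₁ ?_ ?_ ?_ ?_ t₄ ?_
    all_goals
      clear * - E₁ E₄ d₁ d₂ d₃ d₄ h₁₂ h₁₃ h₁₄ h₂₃ h₂₄ h₃₄ hx₁ hx₂ hx₃ hx₄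
      grind
  clear c₁ c₂ c₃ c₄ hq E₁ E₂ E₃ E₄ h
  refine ⟨_, _, _, _, ⟨?_, ?_, ?_, ?_, ?_, ?_, ?_, ?_, ?_, ?_⟩, f₁, f₂, f₃, f₄⟩
  all_goals clear f₁ f₂ f₃ f₄
  · rw [Finset.card_insert_of_notMem (by grind), Finset.card_insert_of_notMem (by grind), t₁]; omega
  · rw [Finset.card_insert_of_notMem (by grind), Finset.card_insert_of_notMem (by grind), t₂]; omega
  · rw [Finset.card_insert_of_notMem (by grind), Finset.card_insert_of_notMem (by grind), t₃]; omega
  · rw [Finset.card_insert_of_notMem (by grind), Finset.card_insert_of_notMem (by grind), t₄]; omega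
  all_goals clear t₁ t₂ t₃ t₄ m₁ m₂ m₃ m₄ n₁ n₂ n₃ n₄ hV
  · exact Finset.card_eq_one.2 ⟨u, by ext w; grind⟩
  · exact Finset.card_eq_one.2 ⟨x₃, by ext w; grind⟩
  · exact Finset.card_eq_one.2 ⟨x₁, by ext w; grind⟩
  · exact Finset.card_eq_one.2 ⟨x₂, by ext w; grind⟩
  · rw [Finset.disjoint_left]; grind
  · rw [Finset.disjoint_left]; grind

end Unequal

/-! ### Paths from cycles, and the main result -/

section Paths

variable {V : Type*} [DecidableEq V] {k : ℕ} {c : Finset V → Bool} {b : Bool}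

/-- A loose triangle of colour `b` and two further vertices: either the triangle can be turned into
a loose path of colour `b`, or the other colour has a loose triangle and a loose path. -/
lemma MonoTri.monoPath3_or [Fintype V] (hk : 3 ≤ k) (hV : Fintype.card V = 3 * k - 1)
    (hm : MonoTri k c b) : MonoPath3 k c b ∨ MonoTri k c (!b) ∧ MonoPath3 k c (!b) := by
  by_contra! hcon
  obtain ⟨h, hcon⟩ := hcon
  obtain ⟨e₁, e₂, e₃, ht, c₁, c₂, c₃⟩ := hm
  have ht₁₃ : (e₁ ∩ e₃).card = 1 := by rw [Finset.inter_comm, ht.inter₃₁]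
  have ht₂₁ : (e₂ ∩ e₁).card = 1 := by rw [Finset.inter_comm, ht.inter₁₂]
  obtain ⟨v₁, v₂, v₃, X₁, X₂, X₃, E₁, E₂, E₃, n₁, n₂, n₃, d₁, d₂, d₃, h₁₂, h₁₃, h₂₃⟩ :=
    ht.exists_parts
  obtain ⟨u, hu, v, hv, huv⟩ : ∃ u ∈ (insert v₁ (insert v₂ (insert v₃ (X₁ ∪ X₂ ∪ X₃))))ᶜ,
      ∃ v ∈ (insert v₁ (insert v₂ (insert v₃ (X₁ ∪ X₂ ∪ X₃))))ᶜ, u ≠ v := by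
    refine Finset.one_lt_card.1 ?_
    have := card_union_parts₃ (v₁ := v₁) (v₂ := v₂) (v₃ := v₃) (by omega) n₁ n₂ n₃
    rw [Finset.card_compl, hV]
    omega
  simp only [Finset.mem_compl, Finset.mem_insert, Finset.mem_union, not_or] at hu hv
  obtain ⟨x₂, hx₂⟩ : X₂.Nonempty := Finset.card_pos.1 (by omega)
  have m₂ : (X₂.erase x₂).card = k - 3 := by rw [Finset.card_erase_of_mem hx₂, n₂]; rfl
  have t₁ : (insert u X₁).card = k - 1 := by
    rw [Finset.card_insert_of_notMem (by simp [hu]), n₁]; omega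
  have t₂ : (insert v X₃).card = k - 1 := by
    rw [Finset.card_insert_of_notMem (by simp [hv]), n₃]; omega
  have t₃ : (insert u (insert v (X₂.erase x₂))).card = k - 1 := by
    rw [Finset.card_insert_of_notMem (by simp [hu, huv]), Finset.card_insert_of_notMem
      (by simp [hv]), m₂]
    omega
  have t₄ : (insert v X₂).card = k - 1 := by
    rw [Finset.card_insert_of_notMem (by simp [hv]), n₂]; omega
  have f₁ : c (insert v₁ (insert u X₁)) = !b := by
    refine eq_not_of_not_monoPath3 (by omega) h ht.card₂ ht.card₃ ht.inter₂₃ c₂ c₃ ?_ ?_ t₁ ?_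
    all_goals
      clear * - E₂ E₃ d₁ h₁₂ h₁₃ h₂₃ hu d₂
      grind
  have f₂ : c (insert v₁ (insert v X₃)) = !b := by
    refine eq_not_of_not_monoPath3 (by omega) h ht.card₂ ht.card₁ ht₂₁ c₂ c₁ ?_ ?_ t₂ ?_
    all_goals
      clear * - E₂ E₁ d₃ h₁₂ h₁₃ h₂₃ hv d₂
      grind
  have f₃ : c (insert v₂ (insert u (insert v (X₂.erase x₂)))) = !b := by
    refine eq_not_of_not_monoPath3 (by omega) h ht.card₃ ht.card₁ ht.inter₃₁ c₃ c₁ ?_ ?_ t₃ ?_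
    all_goals
      clear * - E₃ E₁ d₂ d₃ h₁₂ h₁₃ h₂₃ hu hv
      grind
  have f₄ : c (insert v₃ (insert v X₂)) = !b := by
    refine eq_not_of_not_monoPath3 (by omega) h ht.card₁ ht.card₃ ht₁₃ c₁ c₃ ?_ ?_ t₄ ?_
    all_goals
      clear * - E₁ E₃ d₁ d₂ h₁₂ h₁₃ h₂₃ hv
      grind
  clear c₁ c₂ c₃ ht ht₁₃ ht₂₁ E₁ E₂ E₃ h
  have s₁ : (insert v₁ (insert u X₁)).card = k := by
    rw [Finset.card_insert_of_notMem (by grind), t₁]; omega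
  have s₂ : (insert v₁ (insert v X₃)).card = k := by
    rw [Finset.card_insert_of_notMem (by grind), t₂]; omega
  refine hcon ⟨_, _, _, ⟨s₁, s₂, ?_, ?_, ?_, ?_, ?_⟩, f₁, f₂, f₃⟩
    ⟨_, _, _, ⟨s₁, s₂, ?_, ?_, ?_, ?_⟩, f₁, f₂, f₄⟩
  all_goals clear f₁ f₂ f₃ f₄ s₁ s₂ hcon
  · rw [Finset.card_insert_of_notMem (by grind), t₃]; omega
  · exact Finset.card_eq_one.2 ⟨v₁, by ext w; grind⟩
  · exact Finset.card_eq_one.2 ⟨v, by ext w; grind⟩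
  · exact Finset.card_eq_one.2 ⟨u, by ext w; grind⟩
  · rw [Finset.disjoint_left]; grind
  · rw [Finset.card_insert_of_notMem (by grind), t₄]; omega
  · exact Finset.card_eq_one.2 ⟨v₁, by ext w; grind⟩
  · exact Finset.card_eq_one.2 ⟨v, by ext w; grind⟩
  · rw [Finset.disjoint_left]; grind

/-- A loose four-cycle of colour `b` and two further vertices: either the cycle can be turned into
a loose path of colour `b`, or the other colour has a loose triangle, a loose four-cycle and a loose
path with four edges. -/
lemma MonoQuad.monoPath4_or [Fintype V] (hk : 3 ≤ k) (hV : Fintype.card V = 4 * k - 2)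
    (hm : MonoQuad k c b) :
    MonoPath4 k c b ∨ MonoTri k c (!b) ∧ MonoQuad k c (!b) ∧ MonoPath4 k c (!b) := by
  by_contra! hcon
  obtain ⟨h, hcon⟩ := hcon
  obtain ⟨e₁, e₂, e₃, e₄, hq, c₁, c₂, c₃, c₄⟩ := hm
  obtain ⟨v₁, v₂, v₃, v₄, X₁, X₂, X₃, X₄, E₁, E₂, E₃, E₄, n₁, n₂, n₃, n₄, d₁, d₂, d₃, d₄,
    h₁₂, h₁₃, h₁₄, h₂₃, h₂₄, h₃₄⟩ := hq.exists_parts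
  obtain ⟨u, hu, v, hv, huv⟩ :
      ∃ u ∈ (insert v₁ (insert v₂ (insert v₃ (insert v₄ (X₁ ∪ X₂ ∪ X₃ ∪ X₄)))))ᶜ,
      ∃ v ∈ (insert v₁ (insert v₂ (insert v₃ (insert v₄ (X₁ ∪ X₂ ∪ X₃ ∪ X₄)))))ᶜ, u ≠ v := by
    refine Finset.one_lt_card.1 ?_
    have := card_union_parts₄ (v₁ := v₁) (v₂ := v₂) (v₃ := v₃) (v₄ := v₄) (by omega) n₁ n₂ n₃ n₄
    rw [Finset.card_compl, hV]
    omega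
  simp only [Finset.mem_compl, Finset.mem_insert, Finset.mem_union, not_or] at hu hv
  obtain ⟨x₂, hx₂⟩ : X₂.Nonempty := Finset.card_pos.1 (by omega)
  have m₂ : (X₂.erase x₂).card = k - 3 := by rw [Finset.card_erase_of_mem hx₂, n₂]; rfl
  have t₁ : (insert u X₁).card = k - 1 := by
    rw [Finset.card_insert_of_notMem (by simp [hu]), n₁]; omega
  have t₂ : (insert v X₄).card = k - 1 := by
    rw [Finset.card_insert_of_notMem (by simp [hv]), n₄]; omega
  have t₃ : (insert v X₃).card = k - 1 := by
    rw [Finset.card_insert_of_notMem (by simp [hv]), n₃]; omega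
  have t₄ : (insert u X₂).card = k - 1 := by
    rw [Finset.card_insert_of_notMem (by simp [hu]), n₂]; omega
  have t₅ : (insert u (insert v (X₂.erase x₂))).card = k - 1 := by
    rw [Finset.card_insert_of_notMem (by simp [hu, huv]), Finset.card_insert_of_notMem
      (by simp [hv]), m₂]
    omega
  have p₂₃₄ := hq.rotate.isPath3
  have p₃₂₁ := hq.isPath3.reverse
  have p₄₁₂ := hq.rotate.rotate.rotate.isPath3
  have p₃₄₁ := hq.rotate.rotate.isPath3
  have p₁₄₃ := p₃₄₁.reverse
  have f₁ : c (insert v₁ (insert u X₁)) = !b := by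
    refine eq_not_of_not_monoPath4 (by omega) h p₂₃₄ c₂ c₃ c₄ ?_ ?_ t₁ ?_
    all_goals
      clear * - E₂ E₃ E₄ d₁ h₁₂ h₁₃ h₁₄ h₂₃ h₂₄ h₃₄ hu d₃
      grind
  have f₂ : c (insert v₁ (insert v X₄)) = !b := by
    refine eq_not_of_not_monoPath4 (by omega) h p₃₂₁ c₃ c₂ c₁ ?_ ?_ t₂ ?_
    all_goals
      clear * - E₁ E₂ E₃ d₄ h₁₂ h₁₃ h₁₄ h₂₃ h₂₄ h₃₄ hv d₂
      grind
  have f₃ : c (insert v₃ (insert v X₃)) = !b := by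
    refine eq_not_of_not_monoPath4 (by omega) h p₄₁₂ c₄ c₁ c₂ ?_ ?_ t₃ ?_
    all_goals
      clear * - E₁ E₂ E₄ d₃ h₁₂ h₁₃ h₁₄ h₂₃ h₂₄ h₃₄ hv d₁
      grind
  have f₄ : c (insert v₃ (insert u X₂)) = !b := by
    refine eq_not_of_not_monoPath4 (by omega) h p₁₄₃ c₁ c₄ c₃ ?_ ?_ t₄ ?_
    all_goals
      clear * - E₁ E₃ E₄ d₂ h₁₂ h₁₃ h₁₄ h₂₃ h₂₄ h₃₄ hu d₄
      grind
  have f₅ : c (insert v₃ (insert u (insert v (X₂.erase x₂)))) = !b := by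
    refine eq_not_of_not_monoPath4 (by omega) h p₁₄₃ c₁ c₄ c₃ ?_ ?_ t₅ ?_
    all_goals
      clear * - E₁ E₃ E₄ d₂ h₁₂ h₁₃ h₁₄ h₂₃ h₂₄ h₃₄ hu hv d₄
      grind
  have f₆ : c (insert v₂ (insert u X₂)) = !b := by
    refine eq_not_of_not_monoPath4 (by omega) h p₃₄₁ c₃ c₄ c₁ ?_ ?_ t₄ ?_
    all_goals
      clear * - E₁ E₃ E₄ d₂ h₁₂ h₁₃ h₁₄ h₂₃ h₂₄ h₃₄ hu d₄
      grind
  clear c₁ c₂ c₃ c₄ hq p₂₃₄ p₃₂₁ p₄₁₂ p₃₄₁ p₁₄₃ E₁ E₂ E₃ E₄ h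
  have s₁ : (insert v₁ (insert u X₁)).card = k := by
    rw [Finset.card_insert_of_notMem (by grind), t₁]; omega
  have s₂ : (insert v₁ (insert v X₄)).card = k := by
    rw [Finset.card_insert_of_notMem (by grind), t₂]; omega
  have s₃ : (insert v₃ (insert v X₃)).card = k := by
    rw [Finset.card_insert_of_notMem (by grind), t₃]; omega
  refine hcon ⟨_, _, _, ⟨s₁, s₂, ?_, ?_, ?_, ?_, ?_⟩, f₁, f₂, f₅⟩
    ⟨_, _, _, _, ⟨s₁, s₂, s₃, ?_, ?_, ?_, ?_, ?_, ?_, ?_⟩, f₁, f₂, f₃, f₄⟩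
    ⟨_, _, _, _, ⟨?_, s₁, s₂, s₃, ?_, ?_, ?_, ?_, ?_, ?_⟩, f₆, f₁, f₂, f₃⟩
  all_goals clear f₁ f₂ f₃ f₄ f₅ f₆ s₁ s₂ s₃ hcon
  · rw [Finset.card_insert_of_notMem (by grind), t₅]; omega
  · exact Finset.card_eq_one.2 ⟨v₁, by ext w; grind⟩
  · exact Finset.card_eq_one.2 ⟨v, by ext w; grind⟩
  · exact Finset.card_eq_one.2 ⟨u, by ext w; grind⟩
  · rw [Finset.disjoint_left]; grind
  · rw [Finset.card_insert_of_notMem (by grind), t₄]; omega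
  · exact Finset.card_eq_one.2 ⟨v₁, by ext w; grind⟩
  · exact Finset.card_eq_one.2 ⟨v, by ext w; grind⟩
  · exact Finset.card_eq_one.2 ⟨v₃, by ext w; grind⟩
  · exact Finset.card_eq_one.2 ⟨u, by ext w; grind⟩
  · rw [Finset.disjoint_left]; grind
  · rw [Finset.disjoint_left]; grind
  · rw [Finset.card_insert_of_notMem (by grind), t₄]; omega
  · exact Finset.card_eq_one.2 ⟨u, by ext w; grind⟩
  · exact Finset.card_eq_one.2 ⟨v₁, by ext w; grind⟩
  · exact Finset.card_eq_one.2 ⟨v, by ext w; grind⟩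
  · rw [Finset.disjoint_left]; grind
  · rw [Finset.disjoint_left]; grind
  · rw [Finset.disjoint_left]; grind

end Paths

section Forces

variable {k : ℕ}

lemma monoQuad_or_monoTri {V : Type*} [DecidableEq V] [Fintype V] (hk : 3 ≤ k)
    (hV : Fintype.card V = 4 * k - 3) (c : Finset V → Bool) :
    MonoQuad k c true ∨ MonoTri k c false := by
  obtain ⟨b, hb⟩ := exists_monoQuad hk hV c
  cases b with
  | true => exact .inl hb
  | false => exact or_iff_not_imp_right.2 fun h => hb.not_of_not_monoTri hk hV h

lemma exists_embedding_fin {V : Type*} [Fintype V] {n : ℕ} (h : n ≤ Fintype.card V) :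
    Nonempty (Fin n ↪ V) :=
  Function.Embedding.nonempty_of_card_le (by simpa using h)

lemma forces_looseCycle_three (hk : 3 ≤ k) :
    Forces k (3 * k - 2) (looseCycle 3 k) (looseCycle 3 k) := by
  classical
  intro V _ c hV
  obtain ⟨b, hb⟩ := exists_monoTri hk hV c
  cases b with
  | true => exact .inl (hb.copyIn (by omega))
  | false => exact .inr (hb.copyIn (by omega))

lemma forces_starUniform (hk : 3 ≤ k) :
    Forces k (3 * k - 2) (starUniform 3 k) (starUniform 3 k) := by
  classical
  intro V _ c hV
  obtain ⟨b, hb⟩ := exists_monoStar hk hV c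
  cases b with
  | true => exact .inl (hb.copyIn (by omega))
  | false => exact .inr (hb.copyIn (by omega))

lemma forces_looseCycle_four_three (hk : 3 ≤ k) :
    Forces k (4 * k - 3) (looseCycle 4 k) (looseCycle 3 k) := by
  classical
  intro V _ c hV
  exact (monoQuad_or_monoTri hk hV c).imp (·.copyIn (by omega)) (·.copyIn (by omega))

lemma forces_looseCycle_four (hk : 3 ≤ k) :
    Forces k (4 * k - 3) (looseCycle 4 k) (looseCycle 4 k) := by
  classical
  intro V _ c hV
  obtain ⟨b, hb⟩ := exists_monoQuad hk hV c
  cases b with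
  | true => exact .inl (hb.copyIn (by omega))
  | false => exact .inr (hb.copyIn (by omega))

lemma exists_monoTri_of_le {V : Type*} [DecidableEq V] [Fintype V] (hk : 3 ≤ k)
    (hV : 3 * k - 2 ≤ Fintype.card V) (c : Finset V → Bool) : ∃ b, MonoTri k c b := by
  obtain ⟨ι⟩ := exists_embedding_fin hV
  obtain ⟨b, hb⟩ := exists_monoTri hk (Fintype.card_fin _) fun e => c (e.map ι)
  exact ⟨b, hb.map ι⟩

lemma exists_monoQuad_of_le {V : Type*} [DecidableEq V] [Fintype V] (hk : 3 ≤ k)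
    (hV : 4 * k - 3 ≤ Fintype.card V) (c : Finset V → Bool) : ∃ b, MonoQuad k c b := by
  obtain ⟨ι⟩ := exists_embedding_fin hV
  obtain ⟨b, hb⟩ := exists_monoQuad hk (Fintype.card_fin _) fun e => c (e.map ι)
  exact ⟨b, hb.map ι⟩

lemma monoQuad_or_monoTri_of_le {V : Type*} [DecidableEq V] [Fintype V] (hk : 3 ≤ k)
    (hV : 4 * k - 3 ≤ Fintype.card V) (c : Finset V → Bool) :
    MonoQuad k c true ∨ MonoTri k c false := by
  obtain ⟨ι⟩ := exists_embedding_fin hV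
  exact (monoQuad_or_monoTri hk (Fintype.card_fin _) fun e => c (e.map ι)).imp (·.map ι) (·.map ι)

lemma forces_loosePath_three_looseCycle (hk : 3 ≤ k) :
    Forces k (3 * k - 1) (loosePath 3 k) (looseCycle 3 k) := by
  classical
  intro V _ c hV
  obtain ⟨b, hb⟩ := exists_monoTri_of_le hk (by omega) c
  cases b with
  | true =>
    exact (hb.monoPath3_or hk hV).imp (·.copyIn (by omega)) (·.1.copyIn (by omega))
  | false => exact .inr (hb.copyIn (by omega))

lemma forces_loosePath_three (hk : 3 ≤ k) :
    Forces k (3 * k - 1) (loosePath 3 k) (loosePath 3 k) := by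
  classical
  intro V _ c hV
  obtain ⟨b, hb⟩ := exists_monoTri_of_le hk (by omega) c
  have h := hb.monoPath3_or hk hV
  cases b with
  | true => exact h.imp (·.copyIn (by omega)) (·.2.copyIn (by omega))
  | false => exact h.symm.imp (·.2.copyIn (by omega)) (·.copyIn (by omega))

lemma forces_loosePath_four_looseCycle_three (hk : 3 ≤ k) :
    Forces k (4 * k - 2) (loosePath 4 k) (looseCycle 3 k) := by
  classical
  intro V _ c hV
  rcases monoQuad_or_monoTri_of_le hk (by omega) c with hb | hb
  · exact (hb.monoPath4_or hk hV).imp (·.copyIn (by omega)) (·.1.copyIn (by omega))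
  · exact .inr (hb.copyIn (by omega))

lemma monoPath4_or_monoQuad {V : Type*} [DecidableEq V] [Fintype V] (hk : 3 ≤ k)
    (hV : Fintype.card V = 4 * k - 2) (c : Finset V → Bool) :
    MonoPath4 k c true ∨ MonoQuad k c false := by
  obtain ⟨b, hb⟩ := exists_monoQuad_of_le hk (by omega) c
  cases b with
  | true => exact (hb.monoPath4_or hk hV).imp id (·.2.1)
  | false => exact .inr hb

lemma forces_loosePath_four_looseCycle_four (hk : 3 ≤ k) :
    Forces k (4 * k - 2) (loosePath 4 k) (looseCycle 4 k) := by
  classical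
  intro V _ c hV
  exact (monoPath4_or_monoQuad hk hV c).imp (·.copyIn (by omega)) (·.copyIn (by omega))

lemma forces_loosePath_four_three (hk : 3 ≤ k) :
    Forces k (4 * k - 2) (loosePath 4 k) (loosePath 3 k) := by
  classical
  intro V _ c hV
  refine (monoPath4_or_monoQuad hk hV c).imp (·.copyIn (by omega)) ?_
  rintro ⟨e₁, e₂, e₃, e₄, hq, c₁, c₂, c₃, -⟩
  exact MonoPath3.copyIn (by omega) ⟨e₁, e₂, e₃, hq.isPath3, c₁, c₂, c₃⟩

lemma forces_loosePath_four (hk : 3 ≤ k) :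
    Forces k (4 * k - 2) (loosePath 4 k) (loosePath 4 k) := by
  classical
  intro V _ c hV
  obtain ⟨b, hb⟩ := exists_monoQuad_of_le hk (by omega) c
  have h := hb.monoPath4_or hk hV
  cases b with
  | true => exact h.imp (·.copyIn (by omega)) (·.2.2.copyIn (by omega))
  | false => exact h.symm.imp (·.2.2.copyIn (by omega)) (·.copyIn (by omega))

/-- Either some edge is blue, or all edges are red and any injection gives a red copy. -/
lemma forces_completeUniform {α : Type*} {H : Hypergraph α} (hH : H.IsUniform k)
    (hf : H.vertexSet.Finite) (hne : H.vertexSet.Nonempty) :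
    Forces k H.vertexSet.ncard H (completeUniform k k) := by
  classical
  intro V _ c hV
  by_cases hblue : ∃ s : Finset V, s.card = k ∧ c s = false
  · obtain ⟨s, hs, hc⟩ := hblue
    let g : Fin k ≃ s := (Finset.equivFinOfCardEq hs).symm
    have hg : Function.Injective fun i => (g i : V) := Subtype.val_injective.comp g.injective
    refine .inr ⟨fun i => g i, hg.injOn, fun _ _ => Finset.mem_univ _, fun e he => ?_⟩
    have huniv : e = Set.univ := by
      have he' : e.encard = k := he
      refine Set.eq_univ_iff_ncard _ |>.2 ?_
      rw [Set.ncard, he']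
      simp
    refine ⟨s, hs, ?_, hc⟩
    rw [huniv, Set.image_univ]
    ext v
    constructor
    · intro hv
      exact ⟨g.symm ⟨v, hv⟩, by simp⟩
    · rintro ⟨i, rfl⟩
      exact (g i).2
  · push Not at hblue
    have := hf.to_subtype
    obtain ⟨g⟩ : Nonempty (H.vertexSet ≃ V) := by
      rw [← Nat.card_eq_fintype_card] at hV
      exact (Finite.card_eq.1 (by rw [hV, Nat.card_coe_set_eq]))
    obtain ⟨x₀, hx₀⟩ := hne
    let f : α → V := fun v => if h : v ∈ H.vertexSet then g ⟨v, h⟩ else g ⟨x₀, hx₀⟩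
    have hinj : Set.InjOn f H.vertexSet := by
      intro v hv w hw h
      simp only [f, dif_pos hv, dif_pos hw] at h
      exact congrArg Subtype.val (g.injective h)
    refine .inl ⟨f, hinj, fun _ _ => Finset.mem_univ _, fun e he => ?_⟩
    have hsub : e ⊆ H.vertexSet := H.subset_vertexSet_of_mem_edgeSet he
    have hcard : (f '' e).ncard = k := by
      rw [(hinj.mono hsub).ncard_image, Set.ncard, hH e he]
      rfl
    have hs : (f '' e).toFinset.card = k := by rw [← hcard, Set.ncard_eq_toFinset_card']
    exact ⟨(f '' e).toFinset, hs, by simp, by simpa using hblue _ hs⟩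

end Forces

section Ramsey

variable {α β : Type*} {k m n : ℕ} {G : Hypergraph α} {H : Hypergraph β}

/-- The case of `isRamseyNumber_copies` in which no single vertex meets all edges of `H`. -/
lemma isRamseyNumber_copies_two [Finite α] [Finite β] [Nonempty β] {p r : ℕ} (hn : 1 ≤ n)
    (hnm : n ≤ m) (hGp : G.vertexSet.ncard = p) (hp : 1 ≤ p) (hHp : H.vertexSet.ncard ≤ p)
    (hiso : ∀ x, ¬ G.IsIsolated x) (hcov : ∀ x, ∃ e ∈ H.edgeSet, x ∉ e) (hr : r = p + 1)
    (hf : Forces k r G H) :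
    IsRamseyNumber k (G.copies m) (H.copies n) (m * p + 2 * n - 1) := by
  subst hGp hr
  exact isRamseyNumber_copies (t := 2) (by omega) hn hnm (Set.toFinite _) (Set.toFinite _) hp
    (fun _ => hHp) (.inr fun x _ => hiso x)
    (fun T _ => two_le_ncard_of_forall_exists_notMem hcov T) hf

lemma isRamseyNumber_copies_completeUniform (hn : 1 ≤ n) (hnm : n ≤ m)
    (hH : H.IsUniform k) (hf : H.vertexSet.Finite) (hne : H.vertexSet.Nonempty)
    (hiso : 2 ≤ n → ∀ x ∈ H.vertexSet, ¬ H.IsIsolated x) :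
    IsRamseyNumber k (H.copies m) ((completeUniform k k).copies n)
      (m * H.vertexSet.ncard + n - 1) := by
  have hcard : (completeUniform k k).vertexSet.ncard = k := by
    simp [completeUniform, Set.ncard_univ]
  have huniv : Set.univ ∈ (completeUniform k k).edgeSet := by
    simp [completeUniform, Set.encard_univ]
  have := isRamseyNumber_copies (t := 1) (k := k) (H := completeUniform k k) le_rfl hn hnm hf
    (Set.toFinite _) ((Set.ncard_pos hf).2 hne) ?_ ?_
    (fun T _ => one_le_ncard_of_nonempty ⟨_, huniv⟩ T)
    (by simpa using forces_completeUniform hH hf hne)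
  · rwa [one_mul] at this
  · intro h2
    -- some vertex lies in an edge, and this edge has `k` vertices
    obtain ⟨x, hx⟩ := hne
    have := hiso h2 x hx
    simp only [IsIsolated, not_forall, not_not] at this
    obtain ⟨e, he, -⟩ := this
    have hek : e.ncard = k := by
      rw [Set.ncard, hH e he]
      rfl
    rw [hcard, ← hek]
    exact Set.ncard_le_ncard (H.subset_vertexSet_of_mem_edgeSet he) hf
  · rcases Nat.lt_or_ge n 2 with h | h
    · exact .inl (by omega)
    · exact .inr (hiso h)

end Ramsey

end Hypergraph

theorem theorem3p9 (k m n : ℕ) (hk : 3 ≤ k) (hn : 1 ≤ n) (hmn : n ≤ m) :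
    -- (i) loose cycles against loose cycles
    (Hypergraph.IsRamseyNumber k ((Hypergraph.looseCycle 3 k).copies m)
        ((Hypergraph.looseCycle 3 k).copies n) (m * (3 * k - 3) + 2 * n - 1) ∧
      Hypergraph.IsRamseyNumber k ((Hypergraph.looseCycle 4 k).copies m)
        ((Hypergraph.looseCycle 3 k).copies n) (m * (4 * k - 4) + 2 * n - 1) ∧
      Hypergraph.IsRamseyNumber k ((Hypergraph.looseCycle 4 k).copies m)
        ((Hypergraph.looseCycle 4 k).copies n) (m * (4 * k - 4) + 2 * n - 1)) ∧
    -- (ii) loose paths against loose cycles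
    (Hypergraph.IsRamseyNumber k ((Hypergraph.loosePath 3 k).copies m)
        ((Hypergraph.looseCycle 3 k).copies n) (m * (3 * k - 2) + 2 * n - 1) ∧
      Hypergraph.IsRamseyNumber k ((Hypergraph.loosePath 4 k).copies m)
        ((Hypergraph.looseCycle 3 k).copies n) (m * (4 * k - 3) + 2 * n - 1) ∧
      Hypergraph.IsRamseyNumber k ((Hypergraph.loosePath 4 k).copies m)
        ((Hypergraph.looseCycle 4 k).copies n) (m * (4 * k - 3) + 2 * n - 1)) ∧
    -- (iii) loose paths against loose paths
    (Hypergraph.IsRamseyNumber k ((Hypergraph.loosePath 3 k).copies m)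
        ((Hypergraph.loosePath 3 k).copies n) (m * (3 * k - 2) + 2 * n - 1) ∧
      Hypergraph.IsRamseyNumber k ((Hypergraph.loosePath 4 k).copies m)
        ((Hypergraph.loosePath 3 k).copies n) (m * (4 * k - 3) + 2 * n - 1) ∧
      Hypergraph.IsRamseyNumber k ((Hypergraph.loosePath 4 k).copies m)
        ((Hypergraph.loosePath 4 k).copies n) (m * (4 * k - 3) + 2 * n - 1)) ∧
    -- (iv) stars against stars
    Hypergraph.IsRamseyNumber k ((Hypergraph.starUniform 3 k).copies m)
      ((Hypergraph.starUniform 3 k).copies n) (m * (3 * k - 2) + n - 1) ∧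
    -- (v) arbitrary hypergraphs against single edges
    (∀ (α : Type*) (H : Hypergraph α), H.IsUniform k → H.vertexSet.Finite → H.vertexSet.Nonempty →
      (2 ≤ n → ∀ x ∈ H.vertexSet, ¬ H.IsIsolated x) →
      Hypergraph.IsRamseyNumber k (H.copies m) ((Hypergraph.completeUniform k k).copies n)
        (m * H.vertexSet.ncard + n - 1)) ∧
    Hypergraph.IsRamseyNumber k ((Hypergraph.completeUniform k k).copies m)
      ((Hypergraph.completeUniform k k).copies n) (m * k + n - 1) := by
  have hC3 : NeZero (3 * (k - 1)) := ⟨by omega⟩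
  have hC4 : NeZero (4 * (k - 1)) := ⟨by omega⟩
  have hk2 : 2 ≤ k := by omega
  have e3 : 3 * (k - 1) = 3 * k - 3 := by omega
  have e4 : 4 * (k - 1) = 4 * k - 4 := by omega
  have nC3 : (Hypergraph.looseCycle 3 k).vertexSet.ncard = 3 * k - 3 := by
    rw [Hypergraph.ncard_vertexSet_looseCycle, e3]
  have nC4 : (Hypergraph.looseCycle 4 k).vertexSet.ncard = 4 * k - 4 := by
    rw [Hypergraph.ncard_vertexSet_looseCycle, e4]
  have nP3 : (Hypergraph.loosePath 3 k).vertexSet.ncard = 3 * k - 2 := by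
    rw [Hypergraph.ncard_vertexSet_loosePath]; omega
  have nP4 : (Hypergraph.loosePath 4 k).vertexSet.ncard = 4 * k - 3 := by
    rw [Hypergraph.ncard_vertexSet_loosePath]; omega
  have nS3 : (Hypergraph.starUniform 3 k).vertexSet.ncard = 3 * k - 2 := by
    rw [Hypergraph.ncard_vertexSet_starUniform]; omega
  have iC3 := Hypergraph.not_isIsolated_looseCycle (n := 3) hk2 (by omega)
  have iC4 := Hypergraph.not_isIsolated_looseCycle (n := 4) hk2 (by omega)
  have iP3 := Hypergraph.not_isIsolated_loosePath (n := 3) hk2 (by omega)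
  have iP4 := Hypergraph.not_isIsolated_loosePath (n := 4) hk2 (by omega)
  have vC3 := Hypergraph.exists_notMem_looseCycle (n := 3) hk2 (by omega)
  have vC4 := Hypergraph.exists_notMem_looseCycle (n := 4) hk2 (by omega)
  have vP3 := Hypergraph.exists_notMem_loosePath (n := 3) hk2 (by omega)
  have vP4 := Hypergraph.exists_notMem_loosePath (n := 4) hk2 (by omega)
  refine ⟨⟨?_, ?_, ?_⟩, ⟨?_, ?_, ?_⟩, ⟨?_, ?_, ?_⟩, ?_, ?_, ?_⟩
  · exact Hypergraph.isRamseyNumber_copies_two hn hmn nC3 (by omega) (by omega) iC3 vC3 (by omega)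
      (Hypergraph.forces_looseCycle_three hk)
  · exact Hypergraph.isRamseyNumber_copies_two hn hmn nC4 (by omega) (by omega) iC4 vC3 (by omega)
      (Hypergraph.forces_looseCycle_four_three hk)
  · exact Hypergraph.isRamseyNumber_copies_two hn hmn nC4 (by omega) (by omega) iC4 vC4 (by omega)
      (Hypergraph.forces_looseCycle_four hk)
  · exact Hypergraph.isRamseyNumber_copies_two hn hmn nP3 (by omega) (by omega) iP3 vC3 (by omega)
      (Hypergraph.forces_loosePath_three_looseCycle hk)
  · exact Hypergraph.isRamseyNumber_copies_two hn hmn nP4 (by omega) (by omega) iP4 vC3 (by omega)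
      (Hypergraph.forces_loosePath_four_looseCycle_three hk)
  · exact Hypergraph.isRamseyNumber_copies_two hn hmn nP4 (by omega) (by omega) iP4 vC4 (by omega)
      (Hypergraph.forces_loosePath_four_looseCycle_four hk)
  · exact Hypergraph.isRamseyNumber_copies_two hn hmn nP3 (by omega) (by omega) iP3 vP3 (by omega)
      (Hypergraph.forces_loosePath_three hk)
  · exact Hypergraph.isRamseyNumber_copies_two hn hmn nP4 (by omega) (by omega) iP4 vP3 (by omega)
      (Hypergraph.forces_loosePath_four_three hk)
  · exact Hypergraph.isRamseyNumber_copies_two hn hmn nP4 (by omega) (by omega) iP4 vP4 (by omega)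
      (Hypergraph.forces_loosePath_four hk)
  · -- the centre meets all edges of a star, so that here the covering bound is `1`
    have hne : (Hypergraph.starUniform 3 k).edgeSet.Nonempty := ⟨_, 0, by omega, rfl⟩
    have := Hypergraph.isRamseyNumber_copies (t := 1) (k := k) le_rfl hn hmn (Set.toFinite _)
      (Set.toFinite _) (by omega) (fun _ => le_rfl)
      (.inr fun x _ => Hypergraph.not_isIsolated_starUniform (n := 3) hk2 (by omega) x)
      (fun T _ => Hypergraph.one_le_ncard_of_nonempty hne T)
      (by simpa [nS3] using Hypergraph.forces_starUniform hk)
    rwa [one_mul, nS3] at this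
  · intro α H hH hf hne hiso
    exact Hypergraph.isRamseyNumber_copies_completeUniform hn hmn hH hf hne hiso
  · have huniv : Set.univ ∈ (Hypergraph.completeUniform k k).edgeSet := by
      simp [Hypergraph.completeUniform, Set.encard_univ]
    have := Hypergraph.isRamseyNumber_copies_completeUniform (H := Hypergraph.completeUniform k k) hn hmn
      (fun e he => he) (Set.toFinite _) ⟨⟨0, by omega⟩, Set.mem_univ _⟩
      (fun _ x _ h => h _ huniv (Set.mem_univ x))
    simpa [Hypergraph.completeUniform, Set.ncard_univ] using this
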